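/- **Theorem 4.4.** Let $H$ be a real Hilbert space and $A:D(A)\to H$ a positive self-adjoint operator with eigenvalues $0<\lambda_1\le\lambda_2\le\cdots$ and a corresponding orthonormal basis of eigenvectors $(e_n)_{n\ge1}$; let $H^s=D(A^{s/2})$ with norm $\|A^{s/2}v\|_H$ (for $s<0$, the completion of $H$ in this norm). Here $a_n\sim b_n$ means that $|a_n|/|b_n|$ is bounded above and bounded away from $0$ for all large $n$. Suppose $$\lambda_n\sim n^2,\qquad A_n\sim\frac1{\lambda_n^{1/2}(\log\lambda_n)^2},\qquad B_n=\frac{A_n}{\log\lambda_n}\ \text{ whenever }\lambda_n>1,$$ where $A_n>0$, $\sum_n A_n<2\pi$, and $B_n\in\mathbb R$ is arbitrary for the (finitely many) other $n$. Let $I_n\subset[0,2\pi]$ be intervals of length $A_n$ with pairwise disjoint interiors, let $\varphi_n$ belong to the closure of $I_n$, and let $\psi_n\in C^\infty(\mathbb R)$ vanish outside the closure of $I_n$, with $\psi_n(\varphi_k)=\delta_{nk}$ and $\|\psi_n\|_{C^k(\mathbb R)}\le C_kA_n^{-k}$ for all $n$ and $k\ge0$, with $C_k$ independent of $n$. Let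 $\theta\in C_0^\infty(\mathbb R)$ satisfy $\theta(R)=0$ for $R\le0$ and $\theta(R)=1$ for $R\in[1/2,1]$. In polar coordinates $x+iy=Re^{i\varphi}$, $R\ge0$, $\varphi\in[0,2\pi)$, put $$F(x,y)=\sum_{n=1}^\infty B_n\,\theta(R)\,\psi_n(\varphi)\,e_n .$$ Then $F\in C(\mathbb R^2,H^1)\cap C^1(\mathbb R^2,H)$. Moreover, there is $\beta_0>0$ such that for every $\beta\in(0,\beta_0)$ the system $$x'=-\beta x(x^2+y^2-1),\qquad y'=-\beta y(x^2+y^2-1),\qquad \partial_tv+Av=\beta F(x,y)$$ generates a solution semigroup in $\mathbb R^2\times H$ (unique weak solutions on $[0,\infty)$ for all initial data), which has a global attractor $\mathcal A$ (compact, strictly invariant, attracting all bounded sets). The attractor is contained in $\mathbb R^2\times H^s$ for every $s\in\mathbb R$, and its fractal (upper box-counting) dimension $d(s)=\dim_f(\mathcal A,\mathbb R^2\times H^s)\in[0,\infty]$ (with $d(s)=\infty$ if $\mathcal A$ is not totally bounded in $\mathbb R^2\times H^s$) has the following properties: * $d(s)=2$ for every $s\le2$; * $d$ is non-decreasing, and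 $d(s)>2$ for every $s>2$; * $\mathcal A$ is compact in $\mathbb R^2\times H^3$, but $d(3)=\infty$. -/

import Mathlib

open Set Filter Topology Asymptotics
open scoped NNReal ENNReal ContDiff InnerProductSpace

noncomputable section

/-- The Euclidean plane. -/
abbrev Plane : Type := EuclideanSpace ℝ (Fin 2)

section SpectralScale

variable {H : Type*} [NormedAddCommGroup H] [InnerProductSpace ℝ H]

/-- `v ∈ D(A^{s/2})`, where `A` is the positive operator with `A (e n) = lam n • e n`.
For `s ≤ 0` and eigenvalues bounded away from zero every `v : H` has this property. -/
def MemSobolev (e : HilbertBasis ℕ ℝ H) (lam : ℕ → ℝ) (s : ℝ) (v : H) : Prop :=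
  Summable fun n => lam n ^ s * ⟪e n, v⟫_ℝ ^ 2

/-- The operator `A^{s/2}` (the spectral power), meaningful on `D(A^{s/2})`. -/
def sobolevPow (e : HilbertBasis ℕ ℝ H) (lam : ℕ → ℝ) (s : ℝ) (v : H) : H :=
  ∑' n, (lam n ^ (s / 2) * ⟪e n, v⟫_ℝ) • e n

/-- A set `K ⊆ ℝ² × H^s` transported to `ℝ² × H` by `(p, v) ↦ (p, A^{s/2} v)`.

The norm of `H^s = D(A^{s/2})` is `‖A^{s/2} v‖` (for `s < 0`, `H^s` is the completion of `H` in
this norm), so `A^{s/2}` is an isometric isomorphism of `H^s` onto `H`: compactness, covering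
numbers and fractal dimension of `K` in `ℝ² × H^s` are those of this image in `ℝ² × H`. -/
def inSobolev (e : HilbertBasis ℕ ℝ H) (lam : ℕ → ℝ) (s : ℝ) (K : Set (Plane × H)) :
    Set (Plane × H) :=
  (fun u => (u.1, sobolevPow e lam s u.2)) '' K

end SpectralScale

/-- The fractal (upper box-counting) dimension
`limsup_{ε → 0+} log N_ε(K) / log (1/ε)`, with values in `[-∞, ∞]`, where `N_ε(K)` is the minimal
number of `ε`-balls of the ambient space covering `K` (`∞` if there is no finite cover). -/
def fractalDim {X : Type*} [PseudoEMetricSpace X] (K : Set X) : EReal :=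
  limsup (fun ε : ℝ≥0 =>
    ENNReal.log (Metric.externalCoveringNumber ε K : ℝ≥0∞) /
      ((Real.log (1 / (ε : ℝ)) : ℝ) : EReal)) (𝓝[>] 0)

/-- The polar angle of a point of the plane, normalized to `[0, 2π)` (and `0` at the origin). -/
def polarAngle (p : Plane) : ℝ :=
  toIcoMod Real.two_pi_pos 0 (Complex.arg ⟨p 0, p 1⟩)

section Evolution

variable {H : Type*} [NormedAddCommGroup H] [InnerProductSpace ℝ H]

/-- The map `F(x, y) = ∑ₙ Bₙ θ(R) ψₙ(φ) eₙ`, where `(R, φ)` are the polar coordinates of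
`(x, y)`. When the `ψ n` have disjoint supports, at most one term is non-zero. -/
def sectorMap (e : HilbertBasis ℕ ℝ H) (B : ℕ → ℝ) (θ : ℝ → ℝ) (ψ : ℕ → ℝ → ℝ) (p : Plane) : H :=
  ∑' n, (B n * θ ‖p‖ * ψ n (polarAngle p)) • e n

/-- `u = (x, y, v)` solves, for `t ≥ 0`, the system
`x' = -β x (x² + y² - 1)`, `y' = -β y (x² + y² - 1)`, `v' + A v = β F(x, y)`.
The planar equations hold classically, the last one weakly: `v` is continuous with values in `H`
and `d/dt ⟨w, v⟩ = -⟨A w, v⟩ + β ⟨w, F(x, y)⟩` for every `w ∈ D(A)` (equivalently, `v` is a mild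
solution). -/
structure IsForwardSolution (A : H →ₗ.[ℝ] H) (F : Plane → H) (β : ℝ) (u : ℝ → Plane × H) :
    Prop where
  continuousOn : ContinuousOn u (Ici 0)
  planar : ∀ t : ℝ, 0 ≤ t →
    HasDerivWithinAt (fun τ => (u τ).1)
      ((-β * ((u t).1 0 ^ 2 + (u t).1 1 ^ 2 - 1)) • (u t).1) (Ici 0) t
  weak : ∀ w : A.domain, ∀ t : ℝ, 0 ≤ t →
    HasDerivWithinAt (fun τ => ⟪(w : H), (u τ).2⟫_ℝ)
      (-⟪A w, (u t).2⟫_ℝ + β * ⟪(w : H), F (u t).1⟫_ℝ) (Ici 0) t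

/-- `S t`, `t ≥ 0`, is the solution semigroup of the system: for every initial value `u₀`,
`t ↦ S t u₀` is the one and only solution on `[0, ∞)` starting at `u₀`. -/
def IsSolutionSemigroup (A : H →ₗ.[ℝ] H) (F : Plane → H) (β : ℝ)
    (S : ℝ → Plane × H → Plane × H) : Prop :=
  ∀ u₀ : Plane × H,
    S 0 u₀ = u₀ ∧ IsForwardSolution A F β (fun t => S t u₀) ∧
      ∀ u : ℝ → Plane × H, IsForwardSolution A F β u → u 0 = u₀ → ∀ t : ℝ, 0 ≤ t → u t = S t u₀

end Evolution

/-- `K` is the global attractor of `S t`, `t ≥ 0`: it is compact, strictly invariant, and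
attracts every bounded set uniformly. (There is at most one such `K`.) -/
structure IsGlobalAttractor {X : Type*} [PseudoMetricSpace X] (S : ℝ → X → X) (K : Set X) :
    Prop where
  isCompact : IsCompact K
  invariant : ∀ t : ℝ, 0 ≤ t → S t '' K = K
  attracts : ∀ D : Set X, Bornology.IsBounded D → ∀ ε : ℝ, 0 < ε →
    ∃ T : ℝ, ∀ t : ℝ, T ≤ t → 0 ≤ t → S t '' D ⊆ Metric.thickening ε K

end

/-! The planar flow preserves the polar angle, so along any orbit at most one mode `n` of the second
equation is forced, and everything reduces to scalar equations `k' = -λₙ k + θ(R(t))`. In the closed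
unit disk radial orbits exist for all times, and the unique bounded complete solution is given by
`profile`. The attractor is therefore the graph, over the closed disk, of `v = ∑ β Bₙ kₙ(R) ψₙ(φ)
eₙ`. It is invariant by `profile_radialFlow`. It attracts because the heat part decays and the
planar orbits starting outside the disk approach the unit circle
(`isGlobalAttractor_sectorAttractor`).

If `4β ≤ λ₀`, the decay beats the backward expansion `exp (-2βt)` of the radial flow, so `kₙ` is
Lipschitz with constant of order `1/λₙ` (`abs_profile_sub_le`), while `kₙ(1) = 1/λₙ`. In the `H^s`
norm the `n`-th sector thus has height of order at most `λₙ^(s/2-1) |Bₙ|` and slope at most about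
that times `1/Aₙ`. As the sectors are disjoint, no summation over `n` occurs: a vanishing sequence
of heights gives continuity, bounded slopes give a Lipschitz graph. Three cases follow.

For `s = 2` the slopes are controlled by `Bₙ/Aₙ`, which is bounded, so the graph has the dimension 2
of the disk. Projection to the plane gives the reverse bound for every `s`, and monotonicity in `s`
covers `s < 2`.

For `s > 2` the graph contains, over radial segments of fixed length in the directions `φₙ`, curves
at height at least `c n^(-κ)` along `eₙ`, for any positive `κ > 3 - s`. At scale `ε` about
`ε^(-1/κ)` of these orthogonal curves are still visible, each contributing about `1/ε` separated
points, so the dimension is at least `1 + 1/κ` (`le_fractalDim_of_orthogonal_segments`). Some `κ <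
1` is admissible as soon as `s > 2`.

For `s = 3` every `κ > 0` is admissible and the dimension is infinite, yet the heights `λₙ^(1/2) Bₙ`
tend to zero thanks to the logarithms, so the graph stays compact. -/

noncomputable section

/-! ### Box-counting dimension: power bounds, Lipschitz images, the unit disk. -/

section FractalDim

open Metric

/-- Trades the extended-real quotient in `fractalDim` for a power bound on the covering number; the
values `0` and `∞` of `N` need no separate treatment. -/
lemma log_div_le_iff {N : ℝ≥0∞} {ε : ℝ} (h0 : 0 < ε) (h1 : ε < 1) (b : ℝ) :
    ENNReal.log N / ((Real.log (1 / ε) : ℝ) : EReal) ≤ b ↔ N ≤ ENNReal.ofReal (ε ^ (-b)) := by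
  have hl : 0 < Real.log (1 / ε) := Real.log_pos (by rw [lt_div_iff₀ h0]; linarith)
  rw [EReal.div_le_iff_le_mul (by exact_mod_cast hl) (EReal.coe_ne_top _), ← EReal.coe_mul,
    ← ENNReal.log_le_log_iff, ENNReal.log_ofReal_of_pos (Real.rpow_pos_of_pos h0 _),
    Real.log_rpow h0, Real.log_div one_ne_zero h0.ne', Real.log_one]
  ring_nf

lemma le_log_div_iff {N : ℝ≥0∞} {ε : ℝ} (h0 : 0 < ε) (h1 : ε < 1) (b : ℝ) :
    (b : EReal) ≤ ENNReal.log N / ((Real.log (1 / ε) : ℝ) : EReal) ↔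
      ENNReal.ofReal (ε ^ (-b)) ≤ N := by
  have hl : 0 < Real.log (1 / ε) := Real.log_pos (by rw [lt_div_iff₀ h0]; linarith)
  rw [EReal.le_div_iff_mul_le (by exact_mod_cast hl) (EReal.coe_ne_top _), ← EReal.coe_mul,
    ← ENNReal.log_le_log_iff, ENNReal.log_ofReal_of_pos (Real.rpow_pos_of_pos h0 _),
    Real.log_rpow h0, Real.log_div one_ne_zero h0.ne', Real.log_one]
  ring_nf

lemma eventually_small {δ : ℝ} (hδ : 0 < δ) :
    ∀ᶠ ε : ℝ≥0 in 𝓝[>] 0, 0 < (ε : ℝ) ∧ (ε : ℝ) < δ := by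
  have h : Ioo (0 : ℝ≥0) δ.toNNReal ∈ 𝓝[>] (0 : ℝ≥0) :=
    Ioo_mem_nhdsGT (Real.toNNReal_pos.2 hδ)
  filter_upwards [h] with ε hε
  refine ⟨NNReal.coe_pos.2 hε.1, ?_⟩
  have := NNReal.coe_lt_coe.2 hε.2
  rwa [Real.coe_toNNReal _ hδ.le] at this

/-- Constants are absorbed by powers: `C ≤ ε ^ (-η)` for all small `ε`. -/
lemma exists_le_rpow_neg (C : ℝ) {η : ℝ} (hη : 0 < η) :
    ∃ δ : ℝ, 0 < δ ∧ ∀ ε : ℝ, 0 < ε → ε < δ → C ≤ ε ^ (-η) := by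
  have h := tendsto_rpow_neg_nhdsGT_zero (y := -η) (by linarith)
  have h2 := h.eventually (eventually_ge_atTop C)
  rcases (mem_nhdsGT_iff_exists_Ioo_subset.1 h2) with ⟨δ, hδ, hs⟩
  exact ⟨δ, hδ, fun ε h0 h1 => hs ⟨h0, h1⟩⟩

variable {X Y : Type*} [PseudoEMetricSpace X] [PseudoEMetricSpace Y]

lemma fractalDim_le_of_covering_le {K : Set X} {b C : ℝ}
    (h : ∀ᶠ ε : ℝ≥0 in 𝓝[>] 0,
      (externalCoveringNumber ε K : ℝ≥0∞) ≤ ENNReal.ofReal (C * (ε : ℝ) ^ (-b))) :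
    fractalDim K ≤ b := by
  refine EReal.le_of_forall_lt_iff_le.1 fun z hz => ?_
  have hbz : b < z := by exact_mod_cast hz
  obtain ⟨δ, hδ, hC⟩ := exists_le_rpow_neg C (sub_pos.2 hbz)
  refine limsup_le_of_le (by isBoundedDefault) ?_
  filter_upwards [h, eventually_small hδ, eventually_small one_pos] with ε h1 h2 h3
  rw [log_div_le_iff h3.1 h3.2]
  refine h1.trans (ENNReal.ofReal_le_ofReal ?_)
  calc C * (ε : ℝ) ^ (-b) ≤ (ε : ℝ) ^ (-(z - b)) * (ε : ℝ) ^ (-b) :=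
        mul_le_mul_of_nonneg_right (hC ε h2.1 h2.2) (Real.rpow_nonneg h3.1.le _)
    _ = (ε : ℝ) ^ (-z) := by rw [← Real.rpow_add h3.1]; ring_nf

lemma le_fractalDim_of_le_covering {K : Set X} {b c : ℝ} (hc : 0 < c)
    (h : ∀ᶠ ε : ℝ≥0 in 𝓝[>] 0,
      ENNReal.ofReal (c * (ε : ℝ) ^ (-b)) ≤ (externalCoveringNumber ε K : ℝ≥0∞)) :
    (b : EReal) ≤ fractalDim K := by
  refine EReal.ge_of_forall_gt_iff_ge.1 fun z hz => ?_
  have hbz : z < b := by exact_mod_cast hz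
  obtain ⟨δ, hδ, hC⟩ := exists_le_rpow_neg c⁻¹ (sub_pos.2 hbz)
  refine (le_limsup_of_frequently_le (Eventually.frequently ?_) (by isBoundedDefault))
  filter_upwards [h, eventually_small hδ, eventually_small one_pos] with ε h1 h2 h3
  rw [le_log_div_iff h3.1 h3.2]
  refine le_trans (ENNReal.ofReal_le_ofReal ?_) h1
  have h4 := hC ε h2.1 h2.2
  rw [inv_le_iff_one_le_mul₀ hc] at h4
  have h5 : (ε : ℝ) ^ (-b) = (ε : ℝ) ^ (-(b - z)) * (ε : ℝ) ^ (-z) := by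
    rw [← Real.rpow_add h3.1]; ring_nf
  rw [h5]
  nlinarith [Real.rpow_pos_of_pos h3.1 (-z)]

lemma eventually_covering_le_of_fractalDim_lt {K : Set X} {b : ℝ} (h : fractalDim K < b) :
    ∀ᶠ ε : ℝ≥0 in 𝓝[>] 0,
      (externalCoveringNumber ε K : ℝ≥0∞) ≤ ENNReal.ofReal ((ε : ℝ) ^ (-b)) := by
  filter_upwards [eventually_lt_of_limsup_lt h, eventually_small one_pos] with ε h1 h3
  exact (log_div_le_iff h3.1 h3.2 b).1 h1.le

/-- The factor 2 is the price of moving the centres into `K`, the only place where `f` is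
controlled. -/
lemma externalCoveringNumber_image_le {K : Set X} {f : X → Y} {L : ℝ≥0}
    (hf : LipschitzOnWith L f K) (ε : ℝ≥0) :
    externalCoveringNumber (L * (2 * ε)) (f '' K) ≤ externalCoveringNumber ε K := by
  refine le_trans ?_ (coveringNumber_two_mul_le_externalCoveringNumber ε K)
  by_cases h : coveringNumber (2 * ε) K = ⊤
  · rw [h]; exact le_top
  obtain ⟨C, hCK, -, hC, hcard⟩ := exists_set_encard_eq_coveringNumber h
  rw [← hcard]
  refine le_trans (IsCover.externalCoveringNumber_le_encard (C := f '' C) ?_) (encard_image_le _ _)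
  rintro _ ⟨x, hx, rfl⟩
  obtain ⟨y, hy, hxy⟩ := hC hx
  refine ⟨f y, mem_image_of_mem f hy, ?_⟩
  have h1 := hf hx (hCK hy)
  have h2 : edist x y ≤ ((2 * ε : ℝ≥0) : ℝ≥0∞) := hxy
  show edist (f x) (f y) ≤ _
  calc edist (f x) (f y) ≤ L * edist x y := h1
    _ ≤ L * ((2 * ε : ℝ≥0) : ℝ≥0∞) := by gcongr
    _ = _ := by push_cast; ring

/-- Lipschitz maps do not increase the fractal dimension. -/
theorem LipschitzOnWith.fractalDim_image_le {K : Set X} {f : X → Y} {L : ℝ≥0}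
    (hf : LipschitzOnWith L f K) : fractalDim (f '' K) ≤ fractalDim K := by
  refine EReal.le_of_forall_lt_iff_le.1 fun b hb => ?_
  have hM : (0 : ℝ) < 2 * (L + 1) := by positivity
  have h := eventually_covering_le_of_fractalDim_lt hb
  obtain ⟨δ, hδ, hs⟩ := mem_nhdsGT_iff_exists_Ioo_subset.1 h
  -- The image at scale `ε` is compared with `K` at scale `ε / (2 (L + 1))`; using `L + 1` instead
  -- of `L` avoids dividing by zero.
  refine fractalDim_le_of_covering_le (C := (2 * (L + 1) : ℝ) ^ b) ?_
  have hδ' : (0 : ℝ) < δ * (2 * (L + 1)) := mul_pos (NNReal.coe_pos.2 hδ) hM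
  filter_upwards [eventually_small hδ'] with ε hε
  set ε' : ℝ≥0 := ε / (2 * (L + 1)) with hε'
  have h1 : ε' ∈ Ioo 0 δ := by
    constructor
    · have : 0 < ε := NNReal.coe_pos.1 hε.1
      positivity
    · rw [← NNReal.coe_lt_coe, hε']
      push_cast
      rw [div_lt_iff₀ hM]; exact hε.2
  have h2 := hs h1
  have h3 : L * (2 * ε') ≤ ε := by
    rw [← NNReal.coe_le_coe, hε']
    push_cast
    have : (L : ℝ) * (2 * (ε / (2 * (L + 1)))) = L / (L + 1) * ε := by field_simp
    rw [this]
    refine mul_le_of_le_one_left hε.1.le ?_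
    rw [div_le_one (by positivity)]; linarith
  have h4 : (externalCoveringNumber ε (f '' K) : ℝ≥0∞) ≤ externalCoveringNumber ε' K := by
    exact_mod_cast (externalCoveringNumber_anti h3).trans (externalCoveringNumber_image_le hf ε')
  refine (h4.trans h2).trans (ENNReal.ofReal_le_ofReal (le_of_eq ?_))
  rw [hε']
  push_cast
  rw [Real.div_rpow hε.1.le hM.le, Real.rpow_neg hM.le, div_inv_eq_mul, mul_comm]

/-- The cover is a square grid of mesh `ε/2`, each point being rounded down coordinatewise. There
are at most `(7/ε)²` nodes. -/
lemma externalCoveringNumber_closedBall_le {ε : ℝ≥0} (h0 : 0 < (ε : ℝ)) (h1 : (ε : ℝ) < 1) :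
    (externalCoveringNumber ε (closedBall (0 : Plane) 1) : ℝ≥0∞) ≤
      ENNReal.ofReal (100 * (ε : ℝ) ^ (-2 : ℝ)) := by
  set η : ℝ := ε / 2 with hη
  have hη0 : 0 < η := by positivity
  set N : ℤ := ⌈1 / η⌉ with hN
  set g : ℤ × ℤ → Plane := fun ij => !₂[ij.1 * η, ij.2 * η] with hg
  set t : Finset (ℤ × ℤ) := Finset.Icc (-N) N ×ˢ Finset.Icc (-N) N with ht
  have hcov : IsCover ε (closedBall (0 : Plane) 1) (g '' t) := by
    intro p hp
    have hp1 : ‖p‖ ≤ 1 := by simpa using hp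
    have hpi : ∀ i, |p i| ≤ 1 := fun i =>
      (by simpa using PiLp.norm_apply_le p i : |p i| ≤ ‖p‖).trans hp1
    have hfl : ∀ i, ⌊p i / η⌋ ∈ Finset.Icc (-N) N := by
      intro i
      have h3 := abs_le.1 (hpi i)
      rw [Finset.mem_Icc]
      constructor
      · rw [Int.le_floor]
        push_cast
        have : 1 / η ≤ N := Int.le_ceil _
        have h5 : -(1 / η) ≤ p i / η := by rw [← neg_div]; gcongr; exact h3.1
        linarith
      · rw [← Int.cast_le (R := ℝ)]
        refine (Int.floor_le _).trans ((?_ : _ ≤ 1 / η).trans (Int.le_ceil _))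
        gcongr; exact h3.2
    have hd : ∀ i, |p i - ⌊p i / η⌋ * η| ≤ η := by
      intro i
      have h3 := Int.floor_le (p i / η)
      have h4 := Int.lt_floor_add_one (p i / η)
      rw [le_div_iff₀ hη0] at h3
      rw [div_lt_iff₀ hη0] at h4
      rw [abs_le]; constructor <;> linarith
    refine ⟨g (⌊p 0 / η⌋, ⌊p 1 / η⌋), mem_image_of_mem _ ?_, ?_⟩
    · rw [ht, Finset.mem_coe, Finset.mem_product]; exact ⟨hfl 0, hfl 1⟩
    · show edist p _ ≤ _
      rw [edist_dist, ENNReal.ofReal_le_iff_le_toReal ENNReal.coe_ne_top, ENNReal.coe_toReal,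
        EuclideanSpace.dist_eq]
      refine Real.sqrt_le_iff.2 ⟨h0.le, ?_⟩
      simp only [Fin.sum_univ_two, hg, Real.dist_eq, sq_abs]
      have h5 := sq_le_sq' (by linarith [abs_nonneg (p 0 - ⌊p 0 / η⌋ * η)]) (hd 0)
      have h6 := sq_le_sq' (by linarith [abs_nonneg (p 1 - ⌊p 1 / η⌋ * η)]) (hd 1)
      rw [sq_abs] at h5 h6
      have : (ε : ℝ) = 2 * η := by rw [hη]; ring
      simp
      nlinarith
  have h2 := hcov.externalCoveringNumber_le_encard.trans (encard_image_le _ _)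
  rw [Set.encard_coe_eq_coe_finsetCard] at h2
  have h3 : (externalCoveringNumber ε (closedBall (0 : Plane) 1) : ℝ≥0∞) ≤ (t.card : ℝ≥0∞) := by
    exact_mod_cast h2
  refine h3.trans ?_
  rw [← ENNReal.ofReal_natCast]
  refine ENNReal.ofReal_le_ofReal ?_
  have hN0 : 0 ≤ N := Int.ceil_nonneg (by positivity)
  have h4 : (t.card : ℝ) = (2 * N + 1) ^ 2 := by
    rw [ht, Finset.card_product, Int.card_Icc]
    push_cast
    have : (((N + 1 - -N).toNat : ℕ) : ℝ) = 2 * N + 1 := by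
      rw [← Int.cast_natCast, Int.toNat_of_nonneg (by linarith)]; push_cast; ring
    rw [this]; ring
  rw [h4, Real.rpow_neg h0.le, Real.rpow_two]
  have h5 : (N : ℝ) < 1 / η + 1 := Int.ceil_lt_add_one _
  have h6 : (2 * N + 1 : ℝ) ≤ 7 * (ε : ℝ)⁻¹ := by
    have h7 : 1 / η = 2 * (ε : ℝ)⁻¹ := by rw [hη]; field_simp
    have h8 : 1 ≤ (ε : ℝ)⁻¹ := (one_le_inv₀ h0).2 h1.le
    rw [h7] at h5; linarith
  have h7 : (0 : ℝ) ≤ 2 * N + 1 := by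
    have : (0 : ℝ) ≤ N := by exact_mod_cast hN0
    linarith
  calc (2 * N + 1 : ℝ) ^ 2 ≤ (7 * (ε : ℝ)⁻¹) ^ 2 := by gcongr
    _ ≤ 100 * ((ε : ℝ) ^ 2)⁻¹ := by
      rw [mul_pow, inv_pow]; nlinarith [inv_nonneg.2 (sq_nonneg (ε : ℝ))]

/-- Comparison of areas, for a cover by disks of radius `2ε` centred in the unit disk. -/
lemma le_externalCoveringNumber_closedBall {ε : ℝ≥0} (h0 : 0 < (ε : ℝ)) :
    ENNReal.ofReal (1 / 4 * (ε : ℝ) ^ (-2 : ℝ)) ≤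
      (externalCoveringNumber ε (closedBall (0 : Plane) 1) : ℝ≥0∞) := by
  refine le_trans ?_ (ENat.toENNReal_le.2 (coveringNumber_two_mul_le_externalCoveringNumber ε _))
  by_cases h : coveringNumber (2 * ε) (closedBall (0 : Plane) 1) = ⊤
  · rw [h]; simp
  obtain ⟨C, -, hfin, hC, hcard⟩ := exists_set_encard_eq_coveringNumber h
  rw [← hcard, hfin.encard_eq_coe_toFinset_card]
  set t := hfin.toFinset with ht
  have hsub : closedBall (0 : Plane) 1 ⊆ ⋃ c ∈ t, closedBall c (2 * ε : ℝ) := by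
    intro p hp
    obtain ⟨y, hy, hxy⟩ := hC hp
    have h2 : edist p y ≤ ((2 * ε : ℝ≥0) : ℝ≥0∞) := hxy
    rw [mem_iUnion₂]
    refine ⟨y, by simpa [ht] using hy, ?_⟩
    rw [mem_closedBall]
    rw [edist_nndist] at h2
    exact_mod_cast h2
  have hvol := (MeasureTheory.measure_mono (μ := MeasureTheory.volume) hsub).trans
    (MeasureTheory.measure_biUnion_finset_le _ _)
  simp only [EuclideanSpace.volume_closedBall_fin_two, Finset.sum_const, nsmul_eq_mul] at hvol
  have hpi : ENNReal.ofReal Real.pi ≠ 0 := by simpa using Real.pi_pos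
  rw [← mul_assoc, ENNReal.mul_le_mul_iff_left hpi ENNReal.ofReal_ne_top,
    ENNReal.ofReal_one, one_pow, ← ENNReal.ofReal_natCast,
    ← ENNReal.ofReal_pow (by positivity), ← ENNReal.ofReal_mul (by positivity),
    ← ENNReal.ofReal_one, ENNReal.ofReal_le_ofReal_iff (by positivity)] at hvol
  rw [ENat.toENNReal_coe, ← ENNReal.ofReal_natCast]
  refine ENNReal.ofReal_le_ofReal ?_
  rw [Real.rpow_neg h0.le, Real.rpow_two, ← div_eq_mul_inv, div_le_iff₀ (by positivity)]
  nlinarith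

theorem fractalDim_closedBall_plane : fractalDim (closedBall (0 : Plane) 1) = 2 := by
  apply le_antisymm
  · refine fractalDim_le_of_covering_le (C := 100) (b := 2) ?_
    filter_upwards [eventually_small one_pos] with ε hε
    exact externalCoveringNumber_closedBall_le hε.1 hε.2
  · refine le_fractalDim_of_le_covering (c := 1 / 4) (b := 2) (by norm_num) ?_
    filter_upwards [eventually_small one_pos] with ε hε
    exact le_externalCoveringNumber_closedBall hε.1

end FractalDim

/-! ### Coordinates in the eigenbasis. -/

section Hilbert

variable {H : Type*} [NormedAddCommGroup H] [InnerProductSpace ℝ H]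

namespace HilbertBasis

lemma ext_inner (e : HilbertBasis ℕ ℝ H) {v w : H} (h : ∀ n, ⟪e n, v⟫_ℝ = ⟪e n, w⟫_ℝ) :
    v = w := by
  apply e.repr.injective
  ext n
  rw [e.repr_apply_apply, e.repr_apply_apply, h]

lemma hasSum_inner_sq (e : HilbertBasis ℕ ℝ H) (v : H) :
    HasSum (fun n => ⟪e n, v⟫_ℝ ^ 2) (‖v‖ ^ 2) := by
  have h := e.hasSum_inner_mul_inner v v
  rw [real_inner_self_eq_norm_sq] at h
  refine h.congr_fun fun n => ?_
  rw [real_inner_comm v (e n), sq]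

lemma exists_hasSum (e : HilbertBasis ℕ ℝ H) {x : ℕ → ℝ} (hx : Summable fun n => x n ^ 2) :
    ∃ v, HasSum (fun n => x n • e n) v ∧ ∀ n, ⟪e n, v⟫_ℝ = x n := by
  have hm : Memℓp x 2 := by
    apply memℓp_gen
    simpa using hx
  refine ⟨e.repr.symm ⟨x, hm⟩, e.hasSum_repr_symm ⟨x, hm⟩, fun n => ?_⟩
  rw [← e.repr_apply_apply, LinearIsometryEquiv.apply_symm_apply]

lemma inner_tsum_smul (e : HilbertBasis ℕ ℝ H) {x : ℕ → ℝ} (hx : Summable fun n => x n ^ 2)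
    (n : ℕ) : ⟪e n, ∑' k, x k • e k⟫_ℝ = x n := by
  obtain ⟨v, hv, h⟩ := e.exists_hasSum hx
  rw [hv.tsum_eq, h]

lemma inner_self_ite (e : HilbertBasis ℕ ℝ H) (m n : ℕ) :
    ⟪e m, e n⟫_ℝ = if m = n then 1 else 0 :=
  orthonormal_iff_ite.1 e.orthonormal m n

lemma norm_le_of_abs_inner_le (e : HilbertBasis ℕ ℝ H) {v w : H} {C : ℝ} (hC : 0 ≤ C)
    (h : ∀ n, |⟪e n, v⟫_ℝ| ≤ C * |⟪e n, w⟫_ℝ|) : ‖v‖ ≤ C * ‖w‖ := by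
  refine le_of_sq_le_sq ?_ (by positivity)
  rw [mul_pow]
  refine hasSum_le (fun n => ?_) (e.hasSum_inner_sq v) ((e.hasSum_inner_sq w).mul_left (C ^ 2))
  have := pow_le_pow_left₀ (abs_nonneg _) (h n) 2
  rwa [mul_pow, sq_abs, sq_abs] at this

end HilbertBasis

/-! ### The scale `H^s`. -/

section Sobolev

variable {e : HilbertBasis ℕ ℝ H} {lam : ℕ → ℝ}

lemma inner_sobolevPow (hlam : ∀ n, 0 < lam n) {s : ℝ} {v : H} (hv : MemSobolev e lam s v) (n : ℕ) :
    ⟪e n, sobolevPow e lam s v⟫_ℝ = lam n ^ (s / 2) * ⟪e n, v⟫_ℝ := by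
  refine e.inner_tsum_smul (x := fun n => lam n ^ (s / 2) * ⟪e n, v⟫_ℝ) ?_ n
  refine hv.congr fun n => ?_
  rw [mul_pow, ← Real.rpow_natCast (lam n ^ (s / 2)), ← Real.rpow_mul (hlam n).le]
  norm_num

lemma sobolevPow_zero (e : HilbertBasis ℕ ℝ H) (lam : ℕ → ℝ) (v : H) :
    sobolevPow e lam 0 v = v := by
  simp only [sobolevPow, zero_div, Real.rpow_zero, one_mul]
  refine Eq.trans (tsum_congr fun n => ?_) (e.hasSum_repr v).tsum_eq
  rw [e.repr_apply_apply]

/-- The embedding of `H^r` into `H^s`: the multiplier `λₙ^((s-r)/2)` is largest at `n = 0`. -/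
lemma norm_sobolevPow_sub_le (hlam : ∀ n, 0 < lam n) (hmono : Monotone lam) {s r : ℝ} (hsr : s ≤ r)
    {v w : H} (hvs : MemSobolev e lam s v) (hvr : MemSobolev e lam r v)
    (hws : MemSobolev e lam s w) (hwr : MemSobolev e lam r w) :
    ‖sobolevPow e lam s v - sobolevPow e lam s w‖ ≤
      lam 0 ^ ((s - r) / 2) * ‖sobolevPow e lam r v - sobolevPow e lam r w‖ := by
  refine e.norm_le_of_abs_inner_le (Real.rpow_nonneg (hlam 0).le _) fun n => ?_
  simp only [inner_sub_right, inner_sobolevPow hlam hvs, inner_sobolevPow hlam hvr,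
    inner_sobolevPow hlam hws, inner_sobolevPow hlam hwr, ← mul_sub, abs_mul]
  rw [← mul_assoc]
  refine mul_le_mul_of_nonneg_right ?_ (abs_nonneg _)
  rw [abs_of_pos (Real.rpow_pos_of_pos (hlam n) _), abs_of_pos (Real.rpow_pos_of_pos (hlam n) _)]
  calc lam n ^ (s / 2) = lam n ^ ((s - r) / 2) * lam n ^ (r / 2) := by
        rw [← Real.rpow_add (hlam n)]; ring_nf
    _ ≤ _ := mul_le_mul_of_nonneg_right
        (Real.rpow_le_rpow_of_nonpos (hlam 0) (hmono (Nat.zero_le n)) (by linarith))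
        (Real.rpow_nonneg (hlam n).le _)

/-- The fractal dimension in `ℝ² × H^s` is non-decreasing in `s`. -/
theorem fractalDim_inSobolev_mono (hlam : ∀ n, 0 < lam n) (hmono : Monotone lam)
    {K : Set (Plane × H)} (hK : ∀ s : ℝ, ∀ u ∈ K, MemSobolev e lam s u.2) :
    Monotone fun s : ℝ => fractalDim (inSobolev e lam s K) := by
  intro s r hsr
  -- `g` selects a preimage in `K`. Composed with `A^{s/2}` it gives a Lipschitz map from the `H^r`
  -- picture of `K` onto its `H^s` picture; the choice does not matter, since the `r`-norm dominates
  -- the `s`-norm.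
  choose! g hg hgu using fun (x : Plane × H) (hx : x ∈ inSobolev e lam r K) => hx
  have hgu' : ∀ u ∈ K, g (u.1, sobolevPow e lam r u.2) ∈ K ∧
      (g (u.1, sobolevPow e lam r u.2)).1 = u.1 ∧
      sobolevPow e lam s (g (u.1, sobolevPow e lam r u.2)).2 = sobolevPow e lam s u.2 := by
    intro u hu
    have hm : (u.1, sobolevPow e lam r u.2) ∈ inSobolev e lam r K := mem_image_of_mem _ hu
    have h1 := hg _ hm
    have h2 := Prod.ext_iff.1 (hgu _ hm)
    dsimp only at h2
    refine ⟨h1, h2.1, ?_⟩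
    have h3 := norm_sobolevPow_sub_le hlam hmono hsr (hK s _ h1) (hK r _ h1) (hK s _ hu) (hK r _ hu)
    rw [h2.2, sub_self, norm_zero, mul_zero] at h3
    exact sub_eq_zero.1 (norm_le_zero_iff.1 h3)
  have himg : inSobolev e lam s K =
      (fun x => (x.1, sobolevPow e lam s (g x).2)) '' inSobolev e lam r K := by
    simp only [inSobolev, image_image]
    refine image_congr fun u hu => ?_
    rw [(hgu' u hu).2.2]
  show fractalDim (inSobolev e lam s K) ≤ fractalDim (inSobolev e lam r K)
  rw [himg]
  set C : ℝ := lam 0 ^ ((s - r) / 2) with hC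
  have hC0 : 0 ≤ C := Real.rpow_nonneg (hlam 0).le _
  refine LipschitzOnWith.fractalDim_image_le (L := (max 1 C).toNNReal) ?_
  refine LipschitzOnWith.of_dist_le_mul ?_
  rintro _ ⟨u, hu, rfl⟩ _ ⟨w, hw, rfl⟩
  rw [Real.coe_toNNReal _ (by positivity)]
  simp only [(hgu' u hu).2.2, (hgu' w hw).2.2, Prod.dist_eq]
  rw [dist_eq_norm (sobolevPow e lam s u.2)]
  refine max_le ?_ ?_
  · calc dist u.1 w.1 ≤ 1 * max (dist u.1 w.1) _ := by rw [one_mul]; exact le_max_left _ _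
      _ ≤ _ := mul_le_mul_of_nonneg_right (le_max_left _ _) (by positivity)
  · refine (norm_sobolevPow_sub_le hlam hmono hsr (hK s _ hu) (hK r _ hu) (hK s _ hw)
      (hK r _ hw)).trans ?_
    refine mul_le_mul (le_max_right _ _) ?_ (norm_nonneg _) (by positivity)
    rw [← dist_eq_norm]
    exact le_max_right _ _

end Sobolev

/-! ### The semigroup generated by `-A`, strongly continuous and differentiable in the weak sense.
-/

section HeatSemigroup

/-- The semigroup `exp (-t A)`. -/
def heat (e : HilbertBasis ℕ ℝ H) (lam : ℕ → ℝ) (t : ℝ) (v : H) : H :=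
  ∑' n, (Real.exp (-(lam n * t)) * ⟪e n, v⟫_ℝ) • e n

variable {e : HilbertBasis ℕ ℝ H} {lam : ℕ → ℝ}

lemma inner_heat (hlam : ∀ n, 0 < lam n) {t : ℝ} (ht : 0 ≤ t) (v : H) (n : ℕ) :
    ⟪e n, heat e lam t v⟫_ℝ = Real.exp (-(lam n * t)) * ⟪e n, v⟫_ℝ := by
  refine e.inner_tsum_smul (x := fun n => Real.exp (-(lam n * t)) * ⟪e n, v⟫_ℝ) ?_ n
  refine Summable.of_nonneg_of_le (fun n => sq_nonneg _) (fun n => ?_) (e.hasSum_inner_sq v).summable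
  rw [mul_pow]
  refine mul_le_of_le_one_left (sq_nonneg _) (pow_le_one₀ (Real.exp_pos _).le ?_)
  rw [Real.exp_le_one_iff]
  have := mul_nonneg (hlam n).le ht
  linarith

lemma norm_heat_le (hlam : ∀ n, 0 < lam n) (hmono : Monotone lam) {t : ℝ} (ht : 0 ≤ t) (v : H) :
    ‖heat e lam t v‖ ≤ Real.exp (-(lam 0 * t)) * ‖v‖ := by
  refine e.norm_le_of_abs_inner_le (Real.exp_pos _).le fun n => ?_
  rw [inner_heat hlam ht, abs_mul, abs_of_pos (Real.exp_pos _)]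
  refine mul_le_mul_of_nonneg_right (Real.exp_le_exp.2 ?_) (abs_nonneg _)
  have := mul_le_mul_of_nonneg_right (hmono (Nat.zero_le n)) ht
  linarith

lemma heat_zero (hlam : ∀ n, 0 < lam n) (v : H) : heat e lam 0 v = v :=
  e.ext_inner fun n => by simp [inner_heat hlam le_rfl]

lemma heat_sub (hlam : ∀ n, 0 < lam n) {t : ℝ} (ht : 0 ≤ t) (v w : H) :
    heat e lam t (v - w) = heat e lam t v - heat e lam t w :=
  e.ext_inner fun n => by
    simp only [inner_sub_right, inner_heat hlam ht, mul_sub]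

lemma heat_smul_basis (hlam : ∀ n, 0 < lam n) {t : ℝ} (ht : 0 ≤ t) (c : ℝ) (m : ℕ) :
    heat e lam t (c • e m) = (Real.exp (-(lam m * t)) * c) • e m :=
  e.ext_inner fun n => by
    simp only [inner_heat hlam ht, inner_smul_right, e.inner_self_ite]
    split_ifs with h
    · rw [h]; ring
    · simp

lemma exp_neg_mul_le_one {l t : ℝ} (hl : 0 < l) (ht : 0 ≤ t) : Real.exp (-(l * t)) ≤ 1 := by
  rw [Real.exp_le_one_iff]
  have := mul_nonneg hl.le ht
  linarith

lemma continuousOn_heat (hlam : ∀ n, 0 < lam n) (v : H) :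
    ContinuousOn (fun t => heat e lam t v) (Ici 0) := by
  intro t ht
  have ht' : (0 : ℝ) ≤ t := ht
  rw [ContinuousWithinAt, tendsto_iff_norm_sub_tendsto_zero]
  have h : Tendsto (fun τ => ∑' n, ((Real.exp (-(lam n * τ)) - Real.exp (-(lam n * t))) *
      ⟪e n, v⟫_ℝ) ^ 2) (𝓝[Ici 0] t) (𝓝 (∑' _ : ℕ, (0 : ℝ))) := by
    refine tendsto_tsum_of_dominated_convergence (e.hasSum_inner_sq v).summable (fun n => ?_) ?_
    · have hc : Continuous fun τ => ((Real.exp (-(lam n * τ)) - Real.exp (-(lam n * t))) *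
          ⟪e n, v⟫_ℝ) ^ 2 := by fun_prop
      have := hc.tendsto t
      simp only [sub_self, zero_mul, ne_eq, OfNat.ofNat_ne_zero, not_false_eq_true, zero_pow] at this
      exact this.mono_left nhdsWithin_le_nhds
    · filter_upwards [self_mem_nhdsWithin] with τ hτ n
      have hτ' : (0 : ℝ) ≤ τ := hτ
      rw [Real.norm_eq_abs, abs_of_nonneg (sq_nonneg _), mul_pow]
      refine mul_le_of_le_one_left (sq_nonneg _) ?_
      rw [sq_le_one_iff_abs_le_one, abs_le]
      have h1 := exp_neg_mul_le_one (hlam n) hτ'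
      have h2 := exp_neg_mul_le_one (hlam n) ht'
      have h3 := Real.exp_pos (-(lam n * τ))
      have h4 := Real.exp_pos (-(lam n * t))
      constructor <;> linarith
  rw [tsum_zero] at h
  have h2 := h.sqrt
  rw [Real.sqrt_zero] at h2
  refine h2.congr' ?_
  filter_upwards [self_mem_nhdsWithin] with τ hτ
  rw [← Real.sqrt_sq (norm_nonneg (heat e lam τ v - heat e lam t v)),
    ← (e.hasSum_inner_sq _).tsum_eq]
  congr 2
  ext n
  rw [inner_sub_right, inner_heat hlam hτ, inner_heat hlam ht', sub_mul]

lemma inner_basis_apply {A : H →ₗ.[ℝ] H} [CompleteSpace H] (hA : IsSelfAdjoint A)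
    (hAe : ∀ n, ∃ h : e n ∈ A.domain, A ⟨e n, h⟩ = lam n • e n) (w : A.domain) (n : ℕ) :
    ⟪e n, A w⟫_ℝ = lam n * ⟪e n, (w : H)⟫_ℝ := by
  obtain ⟨h, h2⟩ := hAe n
  have hf := LinearPMap.adjoint_isFormalAdjoint hA.dense_domain
  rw [LinearPMap.isSelfAdjoint_def.1 hA] at hf
  have := hf ⟨e n, h⟩ w
  rw [h2, inner_smul_left] at this
  simpa using this.symm

/-- Weak form of `d/dt exp (-t A) v = -A exp (-t A) v`. -/
lemma hasDerivWithinAt_inner_heat (hlam : ∀ n, 0 < lam n) {w w' : H}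
    (hw : ∀ n, ⟪e n, w'⟫_ℝ = lam n * ⟪e n, w⟫_ℝ) (v : H) {t : ℝ} (ht : 0 ≤ t) :
    HasDerivWithinAt (fun τ => ⟪w, heat e lam τ v⟫_ℝ) (-⟪w', heat e lam t v⟫_ℝ) (Ici 0) t := by
  have hsum : ∀ (u : H) (τ : ℝ), 0 ≤ τ → HasSum (fun n => ⟪e n, u⟫_ℝ *
      (Real.exp (-(lam n * τ)) * ⟪e n, v⟫_ℝ)) ⟪u, heat e lam τ v⟫_ℝ := by
    intro u τ hτ
    refine (e.hasSum_inner_mul_inner u (heat e lam τ v)).congr_fun fun n => ?_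
    rw [inner_heat hlam hτ, real_inner_comm u]
  rw [hasDerivWithinAt_iff_tendsto_slope]
  -- Dominating series for the difference quotients: `|exp (-λτ) - exp (-λt)| ≤ λ |τ - t|`, and the
  -- factor `λₙ` is absorbed by turning the coefficients of `w` into those of `w'`.
  have hbound : Summable fun n => |⟪e n, w'⟫_ℝ * ⟪e n, v⟫_ℝ| := by
    have := (e.summable_inner_mul_inner w' v).abs
    refine this.congr fun n => ?_
    rw [real_inner_comm w']
  have hlim : Tendsto (fun τ => ∑' n, slope (fun τ => ⟪e n, w⟫_ℝ *
      (Real.exp (-(lam n * τ)) * ⟪e n, v⟫_ℝ)) t τ) (𝓝[Ici 0 \ {t}] t)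
      (𝓝 (∑' n, -(⟪e n, w'⟫_ℝ * (Real.exp (-(lam n * t)) * ⟪e n, v⟫_ℝ)))) := by
    refine tendsto_tsum_of_dominated_convergence hbound (fun n => ?_) ?_
    · have hd : HasDerivAt (fun τ => ⟪e n, w⟫_ℝ * (Real.exp (-(lam n * τ)) * ⟪e n, v⟫_ℝ))
          (-(⟪e n, w'⟫_ℝ * (Real.exp (-(lam n * t)) * ⟪e n, v⟫_ℝ))) t := by
        have h1 := (((((hasDerivAt_id t).const_mul (lam n)).neg).exp).mul_const
          ⟪e n, v⟫_ℝ).const_mul ⟪e n, w⟫_ℝ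
        refine h1.congr_deriv ?_
        rw [hw]; simp; ring
      exact hasDerivWithinAt_iff_tendsto_slope.1 (hd.hasDerivWithinAt (s := Ici 0))
    · filter_upwards [self_mem_nhdsWithin] with τ hτ n
      have hτ' : (0 : ℝ) ≤ τ := hτ.1
      have hne : τ ≠ t := hτ.2
      rw [slope_def_field, Real.norm_eq_abs, abs_div, div_le_iff₀ (abs_pos.2 (sub_ne_zero.2 hne)),
        ← mul_sub, ← sub_mul, hw]
      have hexp : |Real.exp (-(lam n * τ)) - Real.exp (-(lam n * t))| ≤ lam n * |τ - t| := by
        have key : ∀ x y : ℝ, 0 ≤ x → x ≤ y →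
            |Real.exp (-(lam n * x)) - Real.exp (-(lam n * y))| ≤ lam n * (y - x) := by
          intro x y hx hxy
          have h1 := exp_neg_mul_le_one (hlam n) hx
          have h2 := Real.add_one_le_exp (-(lam n * (y - x)))
          have h3 : Real.exp (-(lam n * y)) =
              Real.exp (-(lam n * x)) * Real.exp (-(lam n * (y - x))) := by
            rw [← Real.exp_add]; ring_nf
          have h4 := exp_neg_mul_le_one (hlam n) (sub_nonneg.2 hxy)
          have h5 := Real.exp_pos (-(lam n * x))
          have h6 := mul_nonneg (hlam n).le (sub_nonneg.2 hxy)
          rw [h3, abs_of_nonneg (by nlinarith)]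
          nlinarith
        rcases le_total τ t with h | h
        · rw [abs_of_nonpos (sub_nonpos.2 h), neg_sub]; exact key τ t hτ' h
        · rw [abs_sub_comm, abs_of_nonneg (sub_nonneg.2 h)]; exact key t τ ht h
      calc |⟪e n, w⟫_ℝ * ((Real.exp (-(lam n * τ)) - Real.exp (-(lam n * t))) * ⟪e n, v⟫_ℝ)|
          = |Real.exp (-(lam n * τ)) - Real.exp (-(lam n * t))| * |⟪e n, w⟫_ℝ * ⟪e n, v⟫_ℝ| := by
            rw [← abs_mul]; ring_nf
        _ ≤ lam n * |τ - t| * |⟪e n, w⟫_ℝ * ⟪e n, v⟫_ℝ| :=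
            mul_le_mul_of_nonneg_right hexp (abs_nonneg _)
        _ = _ := by
            rw [mul_assoc (lam n) ⟪e n, w⟫_ℝ, abs_mul (lam n), abs_of_pos (hlam n)]; ring
  rw [tsum_neg, (hsum w' t ht).tsum_eq] at hlim
  refine hlim.congr' ?_
  filter_upwards [self_mem_nhdsWithin] with τ hτ
  have hτ' : (0 : ℝ) ≤ τ := hτ.1
  have h1 := ((hsum w τ hτ').sub (hsum w t ht)).div_const (τ - t)
  rw [slope_def_field, ← h1.tsum_eq]
  simp only [slope_def_field]

end HeatSemigroup

end Hilbert

/-! ### Orthogonal sums with at most one non-zero term at each point. -/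

section SparseSum

variable {H : Type*} [NormedAddCommGroup H] [InnerProductSpace ℝ H] {α : Type*}

/-- At every point at most one of the functions `T n` is non-zero. -/
def IsSparse (T : ℕ → α → ℝ) : Prop := ∀ p, ∃ n, ∀ m, m ≠ n → T m p = 0

/-- The vector-valued function with coefficients `T n`. -/
def sparseSum (e : HilbertBasis ℕ ℝ H) (T : ℕ → α → ℝ) (p : α) : H := ∑' n, T n p • e n

variable {e : HilbertBasis ℕ ℝ H} {T : ℕ → α → ℝ}

lemma sparseSum_eq {n : ℕ} {p : α} (h : ∀ m, m ≠ n → T m p = 0) :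
    sparseSum e T p = T n p • e n :=
  tsum_eq_single n fun m hm => by rw [h m hm, zero_smul]

lemma IsSparse.const_mul (hT : IsSparse T) (c : ℕ → ℝ) : IsSparse fun n p => c n * T n p :=
  fun p => (hT p).imp fun n hn m hm => by simp only [hn m hm, mul_zero]

lemma IsSparse.inner_sparseSum (hT : IsSparse T) (p : α) (m : ℕ) :
    ⟪e m, sparseSum e T p⟫_ℝ = T m p := by
  obtain ⟨n, hn⟩ := hT p
  rw [sparseSum_eq hn, inner_smul_right, e.inner_self_ite]
  split_ifs with h
  · rw [h, mul_one]
  · rw [hn m h, mul_zero]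

lemma IsSparse.memSobolev (hT : IsSparse T) (lam : ℕ → ℝ) (s : ℝ) (p : α) :
    MemSobolev e lam s (sparseSum e T p) := by
  obtain ⟨n, hn⟩ := hT p
  refine summable_of_ne_finset_zero (s := {n}) fun m hm => ?_
  rw [hT.inner_sparseSum, hn m (by simpa using hm)]
  simp

lemma IsSparse.sobolevPow_sparseSum (hT : IsSparse T) (lam : ℕ → ℝ) (s : ℝ) (p : α) :
    sobolevPow e lam s (sparseSum e T p) = sparseSum e (fun n p => lam n ^ (s / 2) * T n p) p := by
  simp only [sobolevPow, hT.inner_sparseSum]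
  rfl

lemma norm_smul_basis (e : HilbertBasis ℕ ℝ H) (c : ℝ) (n : ℕ) : ‖c • e n‖ = |c| := by
  rw [norm_smul, e.orthonormal.1, mul_one, Real.norm_eq_abs]

lemma IsSparse.norm_sparseSum_le (hT : IsSparse T) {p : α} {D : ℝ} (h : ∀ n, |T n p| ≤ D) :
    ‖sparseSum e T p‖ ≤ D := by
  obtain ⟨n, hn⟩ := hT p
  rw [sparseSum_eq hn, norm_smul_basis]
  exact h n

/-- The factor 2 covers the case where different terms are active at `p` and `q`: each vanishes at
the other point, so each is itself an increment bounded by `D`. -/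
lemma IsSparse.norm_sparseSum_sub_le (hT : IsSparse T) {p q : α} {D : ℝ}
    (h : ∀ n, |T n p - T n q| ≤ D) : ‖sparseSum e T p - sparseSum e T q‖ ≤ 2 * D := by
  obtain ⟨n, hn⟩ := hT p
  obtain ⟨m, hm⟩ := hT q
  have hD : 0 ≤ D := (abs_nonneg _).trans (h n)
  rw [sparseSum_eq hn, sparseSum_eq hm]
  by_cases hnm : m = n
  · subst hnm
    rw [← sub_smul, norm_smul_basis]
    linarith [h m]
  · have h1 := h n
    have h2 := h m
    rw [hm n (Ne.symm hnm), sub_zero] at h1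
    rw [hn m hnm, zero_sub, abs_neg] at h2
    refine (norm_sub_le _ _).trans ?_
    rw [norm_smul_basis, norm_smul_basis]
    linarith

/-- The tail at `p` is zero or a single term. This is why bounds tending to zero give uniform
convergence without being summable. -/
lemma IsSparse.norm_sub_partialSum_le (hT : IsSparse T) {p : α} {D : ℝ} (hD : 0 ≤ D) {N : ℕ}
    (h : ∀ n, N ≤ n → |T n p| ≤ D) :
    ‖sparseSum e T p - ∑ n ∈ Finset.range N, T n p • e n‖ ≤ D := by
  obtain ⟨n, hn⟩ := hT p
  rw [sparseSum_eq hn]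
  by_cases hnN : n < N
  · rw [Finset.sum_eq_single n (fun m _ hm => by rw [hn m hm, zero_smul])
      (fun h => absurd (Finset.mem_range.2 hnN) h), sub_self, norm_zero]
    exact hD
  · rw [Finset.sum_eq_zero, sub_zero, norm_smul_basis]
    · exact h n (not_lt.1 hnN)
    · intro m hm
      rw [hn m (by rintro rfl; exact hnN (Finset.mem_range.1 hm)), zero_smul]

lemma IsSparse.tendstoUniformlyOn (hT : IsSparse T) {s : Set α} {b : ℕ → ℝ}
    (hb : ∀ n, ∀ p ∈ s, |T n p| ≤ b n) (hb0 : Tendsto b atTop (𝓝 0)) :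
    TendstoUniformlyOn (fun N p => ∑ n ∈ Finset.range N, T n p • e n) (sparseSum e T) atTop s := by
  rw [Metric.tendstoUniformlyOn_iff]
  intro ε hε
  obtain ⟨N, hN⟩ := eventually_atTop.1 (hb0.eventually (gt_mem_nhds (half_pos hε)))
  filter_upwards [eventually_ge_atTop N] with M hM p hp
  rw [dist_eq_norm]
  refine (hT.norm_sub_partialSum_le (half_pos hε).le fun n hn => ?_).trans_lt (half_lt_self hε)
  exact (hb n p hp).trans (hN n (hM.trans hn)).le

lemma IsSparse.continuousOn_sparseSum [TopologicalSpace α] (hT : IsSparse T) {s : Set α}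
    {b : ℕ → ℝ} (hc : ∀ n, ContinuousOn (T n) s)
    (hb : ∀ n, ∀ p ∈ s, |T n p| ≤ b n) (hb0 : Tendsto b atTop (𝓝 0)) :
    ContinuousOn (sparseSum e T) s :=
  (hT.tendstoUniformlyOn hb hb0).continuousOn (Eventually.frequently (Eventually.of_forall
    fun _ => continuousOn_finsetSum _ fun n _ => (hc n).smul continuousOn_const))

/-- A sparse sum of `C¹` functions is `C¹` if the Lipschitz constants of its terms tend to zero. -/
theorem IsSparse.contDiff_sparseSum {E : Type*} [NormedAddCommGroup E] [NormedSpace ℝ E]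
    [CompleteSpace H] {T : ℕ → E → ℝ} (hT : IsSparse T) (hT1 : ∀ n, ContDiff ℝ 1 (T n))
    {L : ℕ → ℝ} (hL : ∀ n p q, |T n p - T n q| ≤ L n * ‖p - q‖) (hL0 : Tendsto L atTop (𝓝 0)) :
    ContDiff ℝ 1 (sparseSum e T) := by
  set P : ℕ → E → H := fun N p => ∑ n ∈ Finset.range N, T n p • e n with hP
  have hPd : ∀ N, ContDiff ℝ 1 (P N) := fun N =>
    ContDiff.sum fun n _ => (hT1 n).smul contDiff_const
  have hptw : ∀ p, Tendsto (fun N => P N p) atTop (𝓝 (sparseSum e T p)) := by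
    intro p
    obtain ⟨n, hn⟩ := hT p
    refine tendsto_const_nhds.congr' ?_
    filter_upwards [eventually_gt_atTop n] with N hN
    rw [sparseSum_eq hn]
    show _ = ∑ n ∈ Finset.range N, T n p • e n
    rw [Finset.sum_eq_single n (fun m _ hm => by rw [hn m hm, zero_smul])
      (fun h => absurd (Finset.mem_range.2 hN) h)]
  -- the difference of two partial sums is Lipschitz with a small constant
  have hlip : ∀ ε : ℝ, 0 < ε → ∃ N, ∀ m ≥ N, ∀ k ≥ N, ∀ p q,
      ‖(P m p - P k p) - (P m q - P k q)‖ ≤ ε * ‖p - q‖ := by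
    intro ε hε
    -- One factor 2 is lost in `norm_sparseSum_sub_le`, another in comparing both partial sums with
    -- the `N`-th.
    obtain ⟨N, hN⟩ := eventually_atTop.1 (hL0.eventually (gt_mem_nhds (show 0 < ε / 4 by linarith)))
    have key : ∀ m ≥ N, ∀ p q,
        ‖(P m p - P N p) - (P m q - P N q)‖ ≤ ε / 2 * ‖p - q‖ := by
      intro m hm p q
      set T' : ℕ → E → ℝ := fun n p => (if n < m ∧ N ≤ n then 1 else 0) * T n p with hT'
      have hT's : IsSparse T' := hT.const_mul _
      have hPm : ∀ p, P m p - P N p = sparseSum e T' p := by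
        intro p
        have h1 : P m p - P N p = ∑ n ∈ Finset.Ico N m, T n p • e n := by
          rw [hP, Finset.sum_Ico_eq_sub _ hm]
        rw [h1, sparseSum, tsum_eq_sum (s := Finset.Ico N m)]
        · refine Finset.sum_congr rfl fun n hn => ?_
          rw [Finset.mem_Ico] at hn
          simp [hT', hn.1, hn.2]
        · intro n hn
          rw [Finset.mem_Ico] at hn
          have : ¬ (n < m ∧ N ≤ n) := fun h => hn ⟨h.2, h.1⟩
          simp [hT', this]
      rw [hPm, hPm]
      have := hT's.norm_sparseSum_sub_le (e := e) (p := p) (q := q) (D := ε / 4 * ‖p - q‖) ?_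
      · linarith
      intro n
      simp only [hT', ← mul_sub, abs_mul]
      split_ifs with h
      · rw [abs_one, one_mul]
        exact (hL n p q).trans (mul_le_mul_of_nonneg_right (hN n h.2).le (norm_nonneg _))
      · simp only [abs_zero, zero_mul]; positivity
    refine ⟨N, fun m hm k hk p q => ?_⟩
    have h1 := key m hm p q
    have h2 := key k hk p q
    have h3 : (P m p - P k p) - (P m q - P k q) =
        ((P m p - P N p) - (P m q - P N q)) - ((P k p - P N p) - (P k q - P N q)) := by abel
    rw [h3]
    refine (norm_sub_le _ _).trans ?_
    linarith
  have hdiff : ∀ N, Differentiable ℝ (P N) := fun N => (hPd N).differentiable one_ne_zero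
  have hder : ∀ ε : ℝ, 0 < ε → ∃ N, ∀ m ≥ N, ∀ k ≥ N, ∀ p,
      ‖fderiv ℝ (P m) p - fderiv ℝ (P k) p‖ ≤ ε := by
    intro ε hε
    obtain ⟨N, hN⟩ := hlip ε hε
    refine ⟨N, fun m hm k hk p => ?_⟩
    rw [← fderiv_sub (hdiff m p) (hdiff k p)]
    refine norm_fderiv_le_of_lip' ℝ hε.le (Eventually.of_forall fun q => ?_)
    simpa using hN m hm k hk q p
  have hcau : ∀ p, CauchySeq fun N => fderiv ℝ (P N) p := by
    intro p
    rw [Metric.cauchySeq_iff]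
    intro ε hε
    obtain ⟨N, hN⟩ := hder (ε / 2) (half_pos hε)
    refine ⟨N, fun m hm k hk => ?_⟩
    rw [dist_eq_norm]
    exact (hN m hm k hk p).trans_lt (half_lt_self hε)
  choose G hG using fun p => cauchySeq_tendsto_of_complete (hcau p)
  have hunif : TendstoUniformly (fun N => fderiv ℝ (P N)) G atTop := by
    rw [Metric.tendstoUniformly_iff]
    intro ε hε
    obtain ⟨N, hN⟩ := hder (ε / 2) (half_pos hε)
    filter_upwards [eventually_ge_atTop N] with m hm p
    rw [dist_comm, dist_eq_norm]
    refine lt_of_le_of_lt ?_ (half_lt_self hε)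
    refine le_of_tendsto ((tendsto_const_nhds.sub (hG p)).norm) ?_
    filter_upwards [eventually_ge_atTop N] with k hk
    exact hN m hm k hk p
  have hF : ∀ p, HasFDerivAt (sparseSum e T) (G p) p := fun p =>
    hasFDerivAt_of_tendstoUniformly hunif (fun N p => (hdiff N p).hasFDerivAt)
      hptw p
  rw [contDiff_one_iff_fderiv]
  refine ⟨fun p => (hF p).differentiableAt, ?_⟩
  have : fderiv ℝ (sparseSum e T) = G := funext fun p => (hF p).fderiv
  rw [this]
  exact hunif.continuous (Eventually.frequently (Eventually.of_forall
    fun N => (hPd N).continuous_fderiv one_ne_zero))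

end SparseSum

/-! ### Polar coordinates: Lipschitz estimates and smoothness of polar bumps. -/

section Polar

/-- A point of the plane as a complex number. -/
def Plane.toComplex (p : Plane) : ℂ := ⟨p 0, p 1⟩

lemma contDiff_toComplex {n : WithTop ℕ∞} : ContDiff ℝ n Plane.toComplex := by
  have : ContDiff ℝ n (fun p : Plane => (p 0, p 1)) := by fun_prop
  exact Complex.equivRealProdCLM.symm.contDiff.comp this

lemma norm_toComplex (p : Plane) : ‖p.toComplex‖ = ‖p‖ := by
  rw [Complex.norm_eq_sqrt_sq_add_sq, EuclideanSpace.norm_eq]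
  simp [Plane.toComplex, Fin.sum_univ_two]

lemma toComplex_ne_zero {p : Plane} (hp : p ≠ 0) : p.toComplex ≠ 0 := by
  rwa [← norm_ne_zero_iff, norm_toComplex, norm_ne_zero_iff]

lemma polarAngle_eq (p : Plane) : polarAngle p = toIcoMod Real.two_pi_pos 0 p.toComplex.arg := rfl

lemma polarAngle_mem (p : Plane) : polarAngle p ∈ Ico 0 (2 * Real.pi) := by
  have h := toIcoMod_mem_Ico Real.two_pi_pos 0 p.toComplex.arg
  rwa [zero_add] at h

lemma polarAngle_eq_of_coe_eq {p : Plane} {x : ℝ} (hx : x ∈ Ico 0 (2 * Real.pi))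
    (h : (x : Real.Angle) = p.toComplex.arg) : polarAngle p = x := by
  obtain ⟨k, hk⟩ := Real.Angle.angle_eq_iff_two_pi_dvd_sub.1 h
  rw [polarAngle_eq, toIcoMod_eq_iff]
  refine ⟨by simpa using hx, -k, ?_⟩
  simp only [zsmul_eq_mul, Int.cast_neg]
  linarith

lemma coe_polarAngle (p : Plane) : (polarAngle p : Real.Angle) = p.toComplex.arg :=
  Real.Angle.coe_toIcoMod _ _

lemma norm_mul_cos_polarAngle (p : Plane) : ‖p‖ * Real.cos (polarAngle p) = p 0 := by
  rw [← norm_toComplex, ← Real.Angle.cos_coe, coe_polarAngle, Real.Angle.cos_coe,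
    Complex.norm_mul_cos_arg]
  rfl

lemma norm_mul_sin_polarAngle (p : Plane) : ‖p‖ * Real.sin (polarAngle p) = p 1 := by
  rw [← norm_toComplex, ← Real.Angle.sin_coe, coe_polarAngle, Real.Angle.sin_coe,
    Complex.norm_mul_sin_arg]
  rfl

lemma polarAngle_smul {r : ℝ} (hr : 0 < r) (p : Plane) : polarAngle (r • p) = polarAngle p := by
  have : (r • p).toComplex = r * p.toComplex := by
    apply Complex.ext <;> simp [Plane.toComplex]
  rw [polarAngle_eq, this, Complex.arg_real_mul _ hr, polarAngle_eq]

/-- The unit vector with polar angle `x`. -/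
def unitVec (x : ℝ) : Plane := !₂[Real.cos x, Real.sin x]

lemma norm_unitVec (x : ℝ) : ‖unitVec x‖ = 1 := by
  rw [EuclideanSpace.norm_eq]
  simp [unitVec, Fin.sum_univ_two]

lemma polarAngle_smul_unitVec {r x : ℝ} (hr : 0 < r) (hx : x ∈ Ico 0 (2 * Real.pi)) :
    polarAngle (r • unitVec x) = x := by
  rw [polarAngle_smul hr]
  apply polarAngle_eq_of_coe_eq hx
  have h : (unitVec x).toComplex = ((x : Real.Angle).cos : ℂ) + (x : Real.Angle).sin * Complex.I := by
    rw [Real.Angle.cos_coe, Real.Angle.sin_coe]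
    apply Complex.ext <;> simp [Plane.toComplex, unitVec, Complex.cos_ofReal_re,
      Complex.sin_ofReal_re]
  rw [h, Complex.arg_cos_add_sin_mul_I_coe_angle]

/-- The law of cosines, written with `1 - cos x = 2 sin² (x/2)`. -/
lemma norm_sub_sq_polar (p q : Plane) : ‖p - q‖ ^ 2 =
    (‖p‖ - ‖q‖) ^ 2 + 4 * ‖p‖ * ‖q‖ * Real.sin ((polarAngle p - polarAngle q) / 2) ^ 2 := by
  have h : ‖p - q‖ ^ 2 = (p 0 - q 0) ^ 2 + (p 1 - q 1) ^ 2 := by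
    rw [EuclideanSpace.norm_sq_eq]; simp [Fin.sum_univ_two]
  rw [h, Real.sin_sq_eq_half_sub, mul_div_cancel₀ _ (two_ne_zero' ℝ), Real.cos_sub,
    ← norm_mul_cos_polarAngle p, ← norm_mul_sin_polarAngle p, ← norm_mul_cos_polarAngle q,
    ← norm_mul_sin_polarAngle q]
  have h1 := Real.sin_sq_add_cos_sq (polarAngle p)
  have h2 := Real.sin_sq_add_cos_sq (polarAngle q)
  linear_combination ‖p‖ ^ 2 * h1 + ‖q‖ ^ 2 * h2

lemma norm_mul_abs_sin_le {p q : Plane} (h : ‖q‖ ≤ ‖p‖) :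
    ‖q‖ * (2 * |Real.sin ((polarAngle p - polarAngle q) / 2)|) ≤ ‖p - q‖ := by
  refine le_of_sq_le_sq ?_ (norm_nonneg _)
  rw [norm_sub_sq_polar, mul_pow, mul_pow, sq_abs]
  have h1 := mul_le_mul_of_nonneg_left h (norm_nonneg q)
  nlinarith [sq_nonneg (‖p‖ - ‖q‖),
    mul_le_mul_of_nonneg_right h1 (sq_nonneg (Real.sin ((polarAngle p - polarAngle q) / 2)))]

/-- A Lipschitz function of the angle, zero at both ends, is Lipschitz for the chordal distance. -/
lemma abs_sub_le_chord {ψ : ℝ → ℝ} {L : ℝ} (hL : ∀ x y, |ψ x - ψ y| ≤ L * |x - y|)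
    (h0 : ψ 0 = 0) (h2π : ψ (2 * Real.pi) = 0) {x y : ℝ} (hx : x ∈ Icc 0 (2 * Real.pi))
    (hy : y ∈ Icc 0 (2 * Real.pi)) :
    |ψ x - ψ y| ≤ L * (4 * |Real.sin ((x - y) / 2)|) := by
  have hL0 : 0 ≤ L := by
    have := (abs_nonneg _).trans (hL 1 0)
    simpa using this
  wlog hxy : y ≤ x generalizing x y
  · rw [abs_sub_comm, ← abs_neg (Real.sin _), ← Real.sin_neg]
    have := this hy hx (le_of_not_ge hxy)
    rwa [← neg_div, neg_sub]
  have hpi := Real.pi_pos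
  have hpi4 := Real.pi_le_four
  -- Jordan's inequality with `2/π ≥ 1/2`; the constant 4 of the statement comes from here.
  have hmul : ∀ z : ℝ, 0 ≤ z → z ≤ Real.pi / 2 → z ≤ 2 * Real.sin z := by
    intro z hz hz'
    have h1 := Real.mul_le_sin hz hz'
    have h2 : 1 / 2 * z ≤ 2 / Real.pi * z := by
      refine mul_le_mul_of_nonneg_right ?_ hz
      rw [div_le_div_iff₀ two_pos hpi]; linarith
    linarith
  rcases le_total (x - y) Real.pi with h | h
  · have h1 := hmul ((x - y) / 2) (by linarith) (by linarith)
    refine (hL x y).trans (mul_le_mul_of_nonneg_left ?_ hL0)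
    rw [abs_of_nonneg (sub_nonneg.2 hxy)]
    linarith [le_abs_self (Real.sin ((x - y) / 2))]
  -- The shorter arc passes through the direction `0 = 2π`, where `ψ` vanishes, so the increment
  -- splits there.
  · have h1 := hmul (Real.pi - (x - y) / 2) (by linarith [hx.2, hy.1]) (by linarith)
    rw [Real.sin_pi_sub] at h1
    have h2 := hL x (2 * Real.pi)
    have h3 := hL y 0
    rw [h2π, sub_zero, abs_of_nonpos (a := x - _) (by linarith [hx.2])] at h2
    rw [h0, sub_zero, sub_zero, abs_of_nonneg hy.1] at h3
    calc |ψ x - ψ y| ≤ |ψ x| + |ψ y| := abs_sub _ _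
      _ ≤ L * (2 * (Real.pi - (x - y) / 2)) := by linarith
      _ ≤ _ := mul_le_mul_of_nonneg_left
        (by linarith [le_abs_self (Real.sin ((x - y) / 2))]) hL0

/-- The function `g(R) ψ(φ)` in polar coordinates. -/
def bump (g ψ : ℝ → ℝ) (p : Plane) : ℝ := g ‖p‖ * ψ (polarAngle p)

variable {g ψ : ℝ → ℝ} {G M L r : ℝ}

/-- The angle is only Lipschitz with constant of order one over the radius; the bound `|g R| ≤ G R`,
used at the inner of the two points, compensates for this. -/
lemma bump_lipschitz (hg0 : ∀ R ∈ Icc 0 r, |g R| ≤ G * R)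
    (hg : ∀ R ∈ Icc 0 r, ∀ R' ∈ Icc 0 r, |g R - g R'| ≤ G * |R - R'|)
    (hM : ∀ x, |ψ x| ≤ M) (hL : ∀ x y, |ψ x - ψ y| ≤ L * |x - y|)
    (h0 : ψ 0 = 0) (h2π : ψ (2 * Real.pi) = 0) {p q : Plane} (hp : ‖p‖ ≤ r) (hq : ‖q‖ ≤ r) :
    |bump g ψ p - bump g ψ q| ≤ G * (M + 2 * L) * ‖p - q‖ := by
  wlog h : ‖q‖ ≤ ‖p‖ generalizing p q
  · rw [abs_sub_comm, norm_sub_rev]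
    exact this hq hp (le_of_not_ge h)
  have hM0 : 0 ≤ M := (abs_nonneg _).trans (hM 0)
  have hL0 : 0 ≤ L := by
    have := (abs_nonneg _).trans (hL 1 0)
    simpa using this
  have hpR : ‖p‖ ∈ Icc 0 r := ⟨norm_nonneg _, hp⟩
  have hqR : ‖q‖ ∈ Icc 0 r := ⟨norm_nonneg _, hq⟩
  rcases eq_or_ne (‖p‖) 0 with hp0 | hp0
  · have hq0 : ‖q‖ = 0 := le_antisymm (h.trans hp0.le) (norm_nonneg _)
    rw [norm_eq_zero] at hp0 hq0
    simp [hp0, hq0]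
  have hG0 : 0 ≤ G := by
    have h1 := (abs_nonneg _).trans (hg0 _ hpR)
    have h2 : 0 < ‖p‖ := lt_of_le_of_ne (norm_nonneg _) (Ne.symm hp0)
    exact nonneg_of_mul_nonneg_left h1 h2
  have h1 := norm_mul_abs_sin_le h
  have h2 := abs_sub_le_chord hL h0 h2π (Ico_subset_Icc_self (polarAngle_mem p))
    (Ico_subset_Icc_self (polarAngle_mem q))
  have h3 : |‖p‖ - ‖q‖| ≤ ‖p - q‖ := abs_norm_sub_norm_le p q
  have h4 : bump g ψ p - bump g ψ q = (g ‖p‖ - g ‖q‖) * ψ (polarAngle p) +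
      g ‖q‖ * (ψ (polarAngle p) - ψ (polarAngle q)) := by simp only [bump]; ring
  rw [h4]
  refine (abs_add_le _ _).trans ?_
  rw [abs_mul, abs_mul]
  have h5 : |g ‖p‖ - g ‖q‖| * |ψ (polarAngle p)| ≤ G * ‖p - q‖ * M := by
    refine mul_le_mul ?_ (hM _) (abs_nonneg _) (by positivity)
    exact (hg _ hpR _ hqR).trans (mul_le_mul_of_nonneg_left h3 hG0)
  have h6 : |g ‖q‖| * |ψ (polarAngle p) - ψ (polarAngle q)| ≤ G * L * 2 * ‖p - q‖ := by
    calc _ ≤ (G * ‖q‖) * (L * (4 * |Real.sin ((polarAngle p - polarAngle q) / 2)|)) :=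
          mul_le_mul (hg0 _ hqR) h2 (abs_nonneg _) (by positivity)
      _ = G * L * 2 * (‖q‖ * (2 * |Real.sin ((polarAngle p - polarAngle q) / 2)|)) := by ring
      _ ≤ _ := mul_le_mul_of_nonneg_left h1 (by positivity)
  linarith

lemma contDiffAt_arg {z : ℂ} (hz : z ∈ Complex.slitPlane) {n : WithTop ℕ∞} :
    ContDiffAt ℝ n Complex.arg z := by
  have h := (Complex.contDiffAt_log hz (n := n)).restrict_scalars ℝ
  have h2 := (Complex.imCLM.contDiff (n := n)).contDiffAt.comp z h
  exact h2.congr_of_eventuallyEq (Eventually.of_forall fun w => (Complex.log_im w).symm)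

/-- The normalized angle jumps across the positive axis, where `arg` is smooth. Since `ψ` vanishes
outside `(0, 2π)`, adding both branches gives an expression that is smooth there. -/
lemma comp_polarAngle_eq (hψ : ∀ x, x ≤ 0 ∨ 2 * Real.pi ≤ x → ψ x = 0) (p : Plane) :
    ψ (polarAngle p) = ψ p.toComplex.arg + ψ (p.toComplex.arg + 2 * Real.pi) := by
  have h1 := Complex.neg_pi_lt_arg p.toComplex
  have h2 := Complex.arg_le_pi p.toComplex
  have hpi := Real.pi_pos
  rcases le_or_gt 0 p.toComplex.arg with h | h
  · rw [polarAngle_eq_of_coe_eq ⟨h, by linarith⟩ rfl, hψ (_ + _) (Or.inr (by linarith)), add_zero]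
  · rw [hψ p.toComplex.arg (Or.inl h.le), zero_add,
      polarAngle_eq_of_coe_eq (x := p.toComplex.arg + 2 * Real.pi) ⟨by linarith, by linarith⟩]
    simp

lemma contDiffAt_comp_polarAngle (hψ : ∀ x, x ≤ 0 ∨ 2 * Real.pi ≤ x → ψ x = 0)
    {n : WithTop ℕ∞} (hψc : ContDiff ℝ n ψ) {p : Plane} (hp : p ≠ 0) :
    ContDiffAt ℝ n (fun q => ψ (polarAngle q)) p := by
  have hz := toComplex_ne_zero hp
  by_cases h : p.toComplex ∈ Complex.slitPlane
  · simp only [comp_polarAngle_eq hψ]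
    have h1 : ContDiffAt ℝ n (fun q : Plane => q.toComplex.arg) p :=
      (contDiffAt_arg h).comp p contDiff_toComplex.contDiffAt
    exact (hψc.contDiffAt.comp p h1).add (hψc.contDiffAt.comp p (h1.add contDiffAt_const))
  -- On the negative axis `arg z` jumps, but `arg (-z) + π` is a smooth branch agreeing with the
  -- normalized angle.
  · have h' : -p.toComplex ∈ Complex.slitPlane := by
      rw [Complex.mem_slitPlane_iff, not_or] at h
      push Not at h
      rw [Complex.mem_slitPlane_iff]
      left
      rw [Complex.neg_re, neg_pos]
      refine lt_of_le_of_ne h.1 fun h0 => hz (Complex.ext h0 h.2)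
    have hev : ∀ᶠ q : Plane in 𝓝 p, -q.toComplex ∈ Complex.slitPlane :=
      (contDiff_toComplex (n := 0)).continuous.neg.continuousAt.eventually_mem
        (Complex.isOpen_slitPlane.mem_nhds h')
    have h1 : ContDiffAt ℝ n (fun q : Plane => (-q.toComplex).arg + Real.pi) p :=
      ((contDiffAt_arg h').comp p contDiff_toComplex.neg.contDiffAt).add contDiffAt_const
    refine (hψc.contDiffAt.comp p h1).congr_of_eventuallyEq ?_
    filter_upwards [hev] with q hq
    have h2 := Complex.neg_pi_lt_arg (-q.toComplex)
    have h3 := Complex.mem_slitPlane_iff_arg.1 hq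
    have h4 := Complex.arg_le_pi (-q.toComplex)
    have h5 : (-q.toComplex).arg < Real.pi := lt_of_le_of_ne h4 h3.1
    simp only [Function.comp]
    rw [polarAngle_eq_of_coe_eq (x := (-q.toComplex).arg + Real.pi) ⟨by linarith, by linarith⟩]
    have h6 : q.toComplex ≠ 0 := neg_ne_zero.1 h3.2
    rw [Real.Angle.coe_add, Complex.arg_neg_coe_angle h6, add_assoc, Real.Angle.coe_pi_add_coe_pi,
      add_zero]

/-- Polar bumps with a flat radial profile are continuously differentiable. -/
theorem contDiff_bump (hg : ContDiff ℝ 1 g) (hg0 : ∀ R ≤ 0, g R = 0) (hψc : ContDiff ℝ 1 ψ)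
    (hψ : ∀ x, x ≤ 0 ∨ 2 * Real.pi ≤ x → ψ x = 0)
    (hM : ∀ x, |ψ x| ≤ M) (hL : ∀ x y, |ψ x - ψ y| ≤ L * |x - y|) :
    ContDiff ℝ 1 (bump g ψ) := by
  have hM0 : 0 ≤ M := (abs_nonneg _).trans (hM 0)
  have hL0 : 0 ≤ L := by
    have := (abs_nonneg _).trans (hL 1 0)
    simpa using this
  have hoff : ∀ p : Plane, p ≠ 0 → ContDiffAt ℝ 1 (bump g ψ) p := fun p hp =>
    (hg.contDiffAt.comp p (contDiffAt_norm ℝ hp)).mul (contDiffAt_comp_polarAngle hψ hψc hp)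
  have hd0 : deriv g 0 = 0 := by
    have h1 := ((hg.differentiable one_ne_zero) 0).hasDerivAt.hasDerivWithinAt (s := Iic 0)
    have h2 : HasDerivWithinAt g 0 (Iic 0) 0 :=
      (hasDerivWithinAt_const (0 : ℝ) (Iic 0) (0 : ℝ)).congr (fun x hx => hg0 x hx) (hg0 0 le_rfl)
    exact (uniqueDiffWithinAt_Iic 0).eq_deriv _ h1 h2
  -- Since `g' (0) = 0`, the Lipschitz constant of the bump on small disks about the origin tends to
  -- zero. This gives both a zero derivative at the origin and its continuity there.
  have hloc : ∀ ε : ℝ, 0 < ε → ∃ r > 0, ∀ p q : Plane, ‖p‖ ≤ r → ‖q‖ ≤ r →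
      |bump g ψ p - bump g ψ q| ≤ ε * ‖p - q‖ := by
    intro ε hε
    set η := ε / (M + 2 * L + 1) with hη
    have hη0 : 0 < η := by positivity
    have hc : ContinuousAt (deriv g) 0 := (hg.continuous_deriv le_rfl).continuousAt
    obtain ⟨δ, hδ, hδ'⟩ := Metric.continuousAt_iff.1 hc η hη0
    have hgL : ∀ R ∈ Icc 0 (δ / 2), ∀ R' ∈ Icc 0 (δ / 2), |g R - g R'| ≤ η * |R - R'| := by
      intro R hR R' hR'
      refine Convex.norm_image_sub_le_of_norm_deriv_le (s := Icc 0 (δ / 2))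
        (fun x _ => hg.differentiable one_ne_zero x) (fun x hx => ?_) (convex_Icc _ _) hR' hR
      have := hδ' (x := x) (by
        rw [Real.dist_eq, sub_zero, abs_of_nonneg hx.1]; linarith [hx.2])
      rw [hd0, dist_zero_right] at this
      exact this.le
    refine ⟨δ / 2, half_pos hδ, fun p q hp hq => ?_⟩
    refine (bump_lipschitz (G := η) (fun R hR => ?_) hgL hM hL (hψ 0 (Or.inl le_rfl))
      (hψ _ (Or.inr le_rfl)) hp hq).trans (mul_le_mul_of_nonneg_right ?_ (norm_nonneg _))
    · have := hgL R hR 0 ⟨le_rfl, (half_pos hδ).le⟩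
      rwa [hg0 0 le_rfl, sub_zero, sub_zero, abs_of_nonneg hR.1] at this
    · rw [hη, div_mul_eq_mul_div, div_le_iff₀ (by positivity)]
      nlinarith
  have hb0 : bump g ψ 0 = 0 := by simp [bump, hg0 0 le_rfl]
  have hat0 : HasFDerivAt (bump g ψ) (0 : Plane →L[ℝ] ℝ) 0 := by
    rw [hasFDerivAt_iff_isLittleO_nhds_zero, isLittleO_iff]
    intro ε hε
    obtain ⟨r, hr, h⟩ := hloc ε hε
    filter_upwards [Metric.closedBall_mem_nhds (0 : Plane) hr] with p hp
    have := h p 0 (by simpa using hp) (by simpa using hr.le)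
    simpa using this
  rw [contDiff_one_iff_fderiv]
  refine ⟨fun p => ?_, continuous_iff_continuousAt.2 fun p => ?_⟩
  · rcases eq_or_ne p 0 with rfl | hp
    · exact hat0.differentiableAt
    · exact (hoff p hp).differentiableAt one_ne_zero
  · rcases eq_or_ne p 0 with rfl | hp
    · rw [Metric.continuousAt_iff]
      intro ε hε
      obtain ⟨r, hr, h⟩ := hloc (ε / 2) (half_pos hε)
      refine ⟨r, hr, fun p hp => ?_⟩
      rw [hat0.fderiv, dist_zero_right]
      refine lt_of_le_of_lt ?_ (half_lt_self hε)
      refine norm_fderiv_le_of_lip' ℝ (half_pos hε).le ?_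
      have hp' : p ∈ Metric.ball (0 : Plane) r := hp
      filter_upwards [Metric.isOpen_ball.mem_nhds hp'] with q hq
      exact h q p (by simpa using (mem_ball_zero_iff.1 hq).le) (mem_ball_zero_iff.1 hp').le
    · exact (hoff p hp).continuousAt_fderiv one_ne_zero

end Polar

/-! ### The explicit planar flow. -/

section PlanarFlow

/-- The ratio `‖p‖² / ‖p(t)‖²` for the planar flow, as a function of `r = ‖p‖²`. -/
def flowDen (β r t : ℝ) : ℝ := r + (1 - r) * Real.exp (-(2 * β * t))

/-- The radius at time `t` of the planar orbit starting at radius `R`. -/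
def radialFlow (β t R : ℝ) : ℝ := R * (√(flowDen β (R ^ 2) t))⁻¹

/-- The flow of `x' = -β x (x² + y² - 1)`, `y' = -β y (x² + y² - 1)`. -/
def planarFlow (β t : ℝ) (p : Plane) : Plane := (√(flowDen β (‖p‖ ^ 2) t))⁻¹ • p

variable {β r t : ℝ}

/-- Valid for negative `t` too: orbits in the closed disk are complete, whereas those outside blow
up backwards in finite time. -/
lemma flowDen_pos_of_le_one (h0 : 0 ≤ r) (h1 : r ≤ 1) : 0 < flowDen β r t := by
  have := Real.exp_pos (-(2 * β * t))
  rcases h0.eq_or_lt with h | h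
  · simp [flowDen, ← h, this]
  · exact add_pos_of_pos_of_nonneg h (mul_nonneg (by linarith) this.le)

lemma flowDen_pos (hβ : 0 < β) (h0 : 0 ≤ r) (ht : 0 ≤ t) : 0 < flowDen β r t := by
  have h1 := exp_neg_mul_le_one (l := 2 * β) (by positivity) ht
  have h2 := Real.exp_pos (-(2 * β * t))
  have : flowDen β r t = r * (1 - Real.exp (-(2 * β * t))) + Real.exp (-(2 * β * t)) := by
    rw [flowDen]; ring
  rw [this]
  exact add_pos_of_nonneg_of_pos (mul_nonneg h0 (by linarith)) h2

lemma flowDen_zero_time : flowDen β r 0 = 1 := by simp [flowDen]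

lemma continuous_flowDen : Continuous fun t => flowDen β r t := by
  unfold flowDen; fun_prop

lemma hasDerivAt_flowDen : HasDerivAt (fun t => flowDen β r t) (-(2 * β) * (flowDen β r t - r)) t := by
  have h := ((((hasDerivAt_id t).const_mul (2 * β)).neg.exp).const_mul (1 - r)).const_add r
  refine h.congr_deriv ?_
  simp [flowDen]; ring

lemma norm_planarFlow (p : Plane) : ‖planarFlow β t p‖ = radialFlow β t ‖p‖ := by
  rw [planarFlow, norm_smul, Real.norm_eq_abs, abs_of_nonneg (by positivity), radialFlow, mul_comm]

lemma planarFlow_zero_time (p : Plane) : planarFlow β 0 p = p := by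
  simp [planarFlow, flowDen_zero_time]

lemma radialFlow_sq {R : ℝ} (h : 0 < flowDen β (R ^ 2) t) :
    radialFlow β t R ^ 2 = R ^ 2 / flowDen β (R ^ 2) t := by
  rw [radialFlow, mul_pow, inv_pow, Real.sq_sqrt h.le, div_eq_mul_inv]

lemma polarAngle_planarFlow {p : Plane} (h : 0 < flowDen β (‖p‖ ^ 2) t) :
    polarAngle (planarFlow β t p) = polarAngle p :=
  polarAngle_smul (inv_pos.2 (Real.sqrt_pos.2 h)) p

lemma sq_add_sq_eq_norm_sq (p : Plane) : p 0 ^ 2 + p 1 ^ 2 = ‖p‖ ^ 2 := by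
  rw [EuclideanSpace.norm_sq_eq]; simp [Fin.sum_univ_two]

lemma hasDerivAt_planarFlow {p : Plane} (h : 0 < flowDen β (‖p‖ ^ 2) t) :
    HasDerivAt (fun τ => planarFlow β τ p)
      ((-β * (planarFlow β t p 0 ^ 2 + planarFlow β t p 1 ^ 2 - 1)) • planarFlow β t p) t := by
  have hs : 0 < √(flowDen β (‖p‖ ^ 2) t) := Real.sqrt_pos.2 h
  have h1 := ((hasDerivAt_flowDen (β := β) (r := ‖p‖ ^ 2) (t := t)).sqrt h.ne').fun_inv hs.ne'
  refine (h1.smul_const p).congr_deriv ?_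
  rw [sq_add_sq_eq_norm_sq, norm_planarFlow, radialFlow_sq h]
  rw [show planarFlow β t p = (√(flowDen β (‖p‖ ^ 2) t))⁻¹ • p from rfl, smul_smul]
  congr 1
  have h2 := Real.sq_sqrt h.le
  set D := flowDen β (‖p‖ ^ 2) t
  rw [h2]
  field_simp
  ring

lemma continuousOn_planarFlow {p : Plane} (hβ : 0 < β) :
    ContinuousOn (fun τ => planarFlow β τ p) (Ici 0) := fun _ ht =>
  (hasDerivAt_planarFlow (flowDen_pos hβ (sq_nonneg _) ht)).continuousAt.continuousWithinAt

/-- The cocycle identity behind the composition laws of the planar and radial flows. -/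
lemma flowDen_add {R s : ℝ} (h : 0 < flowDen β (R ^ 2) s) :
    flowDen β (radialFlow β s R ^ 2) t * flowDen β (R ^ 2) s = flowDen β (R ^ 2) (t + s) := by
  rw [radialFlow_sq h]
  have h1 : Real.exp (-(2 * β * (t + s))) =
      Real.exp (-(2 * β * t)) * Real.exp (-(2 * β * s)) := by rw [← Real.exp_add]; ring_nf
  have h2 : flowDen β (R ^ 2) s - R ^ 2 = (1 - R ^ 2) * Real.exp (-(2 * β * s)) := by
    rw [flowDen]; ring
  have h3 : flowDen β (R ^ 2 / flowDen β (R ^ 2) s) t * flowDen β (R ^ 2) s =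
      R ^ 2 + (flowDen β (R ^ 2) s - R ^ 2) * Real.exp (-(2 * β * t)) := by
    rw [flowDen]; field_simp
  rw [h3, h2, flowDen, h1]; ring

lemma planarFlow_planarFlow {s : ℝ} {p : Plane} (h : 0 < flowDen β (‖p‖ ^ 2) s) :
    planarFlow β t (planarFlow β s p) = planarFlow β (t + s) p := by
  unfold planarFlow
  rw [smul_smul]
  congr 1
  have h1 : ‖(√(flowDen β (‖p‖ ^ 2) s))⁻¹ • p‖ = radialFlow β s ‖p‖ := norm_planarFlow p
  rw [h1, ← flowDen_add h, Real.sqrt_mul' _ h.le, mul_inv]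

lemma radialFlow_radialFlow {s R : ℝ} (h : 0 < flowDen β (R ^ 2) s) :
    radialFlow β t (radialFlow β s R) = radialFlow β (t + s) R := by
  have h1 : radialFlow β (t + s) R =
      R * (√(flowDen β (radialFlow β s R ^ 2) t * flowDen β (R ^ 2) s))⁻¹ := by
    rw [flowDen_add h]; rfl
  have h2 : radialFlow β t (radialFlow β s R) =
      radialFlow β s R * (√(flowDen β (radialFlow β s R ^ 2) t))⁻¹ := rfl
  have h3 : radialFlow β s R = R * (√(flowDen β (R ^ 2) s))⁻¹ := rfl
  rw [h1, h2, Real.sqrt_mul' _ h.le, mul_inv]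
  set X := flowDen β (radialFlow β s R ^ 2) t
  rw [h3]
  ring

lemma radialFlow_nonneg {R : ℝ} (h : 0 ≤ R) : 0 ≤ radialFlow β t R := by
  unfold radialFlow; positivity

lemma sq_le_one_of_mem {R : ℝ} (h : R ∈ Icc (0 : ℝ) 1) : R ^ 2 ≤ 1 :=
  pow_le_one₀ h.1 h.2

lemma radialFlow_mem {R : ℝ} (h : R ∈ Icc (0 : ℝ) 1) : radialFlow β t R ∈ Icc (0 : ℝ) 1 := by
  refine ⟨radialFlow_nonneg h.1, ?_⟩
  have hd := flowDen_pos_of_le_one (β := β) (t := t) (sq_nonneg R) (sq_le_one_of_mem h)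
  rw [← sq_le_one_iff₀ (radialFlow_nonneg h.1), radialFlow_sq hd, div_le_one hd, flowDen]
  have := mul_nonneg (sub_nonneg.2 (sq_le_one_of_mem h)) (Real.exp_pos (-(2 * β * t))).le
  linarith

lemma radialFlow_one : radialFlow β t 1 = 1 := by simp [radialFlow, flowDen]

lemma radialFlow_zero : radialFlow β t 0 = 0 := by simp [radialFlow]

lemma continuousAt_radialFlow {R : ℝ} (h : 0 < flowDen β (R ^ 2) t) :
    ContinuousAt (fun τ => radialFlow β τ R) t := by
  unfold radialFlow
  exact continuousAt_const.mul
    ((continuous_flowDen.continuousAt.sqrt).inv₀ (Real.sqrt_pos.2 h).ne')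

lemma continuous_radialFlow {R : ℝ} (h : R ∈ Icc (0 : ℝ) 1) :
    Continuous fun τ => radialFlow β τ R :=
  continuous_iff_continuousAt.2 fun _ =>
    continuousAt_radialFlow (flowDen_pos_of_le_one (sq_nonneg R) (sq_le_one_of_mem h))

lemma continuous_radialFlow_max (hβ : 0 < β) (R : ℝ) :
    Continuous fun τ => radialFlow β (max τ 0) R :=
  continuous_iff_continuousAt.2 fun τ =>
    ContinuousAt.comp (f := fun τ : ℝ => max τ 0) (g := fun τ => radialFlow β τ R)
      (continuousAt_radialFlow (flowDen_pos hβ (sq_nonneg R) (le_max_right _ _)))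
      (by fun_prop)

/-- Backwards in time the radial flow expands distances in `[0, 1]` at most by `exp (-2 β t)`. -/
lemma abs_radialFlow_sub_le (hβ : 0 < β) (ht : t ≤ 0) {R R' : ℝ} (hR : R ∈ Icc (0 : ℝ) 1)
    (hR' : R' ∈ Icc (0 : ℝ) 1) :
    |radialFlow β t R - radialFlow β t R'| ≤ Real.exp (-(2 * β * t)) * |R - R'| := by
  set E := Real.exp (-(2 * β * t)) with hE
  have hE1 : 1 ≤ E := by
    rw [hE, Real.one_le_exp_iff]
    nlinarith
  refine Convex.norm_image_sub_le_of_norm_hasDerivWithin_le (s := Icc (0 : ℝ) 1)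
    (f := radialFlow β t)
    -- The derivative in `R` is `E / D^(3/2)`, and `D ≥ 1` for `t ≤ 0` inside the disk.
    (f' := fun x => E / (flowDen β (x ^ 2) t * √(flowDen β (x ^ 2) t)))
    (fun x hx => ?_) (fun x hx => ?_) (convex_Icc _ _) hR' hR
  · have hd := flowDen_pos_of_le_one (β := β) (t := t) (sq_nonneg x) (sq_le_one_of_mem hx)
    have hs := Real.sqrt_pos.2 hd
    have h1 : HasDerivAt (fun x => flowDen β (x ^ 2) t) (2 * x * (1 - E)) x := by
      have h2 := hasDerivAt_pow 2 x
      have h3 := h2.add ((h2.const_sub 1).mul_const E)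
      refine h3.congr_deriv ?_
      simp; ring
    have h4 := (hasDerivAt_id x).mul ((h1.sqrt hd.ne').fun_inv hs.ne')
    refine (h4.congr_deriv ?_).hasDerivWithinAt
    have h5 := Real.sq_sqrt hd.le
    have h6 : flowDen β (x ^ 2) t = x ^ 2 + (1 - x ^ 2) * E := rfl
    set D := flowDen β (x ^ 2) t
    simp only [id]
    rw [h5]
    field_simp
    rw [h6]; ring
  · have hd : 1 ≤ flowDen β (x ^ 2) t := by
      have h7 := mul_nonneg (sub_nonneg.2 (sq_le_one_of_mem hx)) (sub_nonneg.2 hE1)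
      have : flowDen β (x ^ 2) t = 1 + (1 - x ^ 2) * (E - 1) := by rw [flowDen]; ring
      linarith
    have hs : 1 ≤ √(flowDen β (x ^ 2) t) := Real.one_le_sqrt.2 hd
    rw [Real.norm_eq_abs, abs_of_nonneg (by positivity)]
    exact div_le_self (by positivity) (one_le_mul_of_one_le_of_one_le hd hs)

/-- Outside the unit disk orbits approach the unit circle at the rate `exp (-2 β t)`. -/
lemma abs_radialFlow_sub_one_le (hβ : 0 < β) (ht : 0 ≤ t) {R : ℝ} (hR : 1 ≤ R) :
    |radialFlow β t R - 1| ≤ R ^ 2 * Real.exp (-(2 * β * t)) := by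
  have hE1 := exp_neg_mul_le_one (l := 2 * β) (by positivity) ht
  have hE0 := Real.exp_pos (-(2 * β * t))
  have hR2 : 1 ≤ R ^ 2 := one_le_pow₀ hR
  have hd := flowDen_pos hβ (sq_nonneg R) ht
  set E := Real.exp (-(2 * β * t)) with hE
  have hDE : flowDen β (R ^ 2) t = R ^ 2 + (1 - R ^ 2) * E := rfl
  have hd1 : 1 ≤ flowDen β (R ^ 2) t := by nlinarith
  have hsq := radialFlow_sq hd
  have h0 := radialFlow_nonneg (β := β) (t := t) (zero_le_one.trans hR)
  have h1 : radialFlow β t R ^ 2 - 1 = (R ^ 2 - 1) * E / flowDen β (R ^ 2) t := by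
    rw [hsq, hDE]; field_simp [hDE ▸ hd.ne']; ring
  have h2 : 0 ≤ radialFlow β t R ^ 2 - 1 := by
    rw [h1]; exact div_nonneg (mul_nonneg (by linarith) hE0.le) hd.le
  have h3 : 1 ≤ radialFlow β t R := by nlinarith
  have h4 : radialFlow β t R ^ 2 - 1 ≤ (R ^ 2 - 1) * E := by
    rw [h1]; exact div_le_self (mul_nonneg (by linarith) hE0.le) hd1
  rw [abs_of_nonneg (by linarith)]
  nlinarith

/-- On a compact time interval both curves stay in one ball, where the cubic field is Lipschitz. -/
lemma planar_unique {q : ℝ → Plane} {p : Plane} (hβ : 0 < β)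
    (hq : ∀ t : ℝ, 0 ≤ t → HasDerivWithinAt q
      ((-β * (q t 0 ^ 2 + q t 1 ^ 2 - 1)) • q t) (Ici 0) t) (h0 : q 0 = p) (ht : 0 ≤ t) :
    q t = planarFlow β t p := by
  have hqc : ContinuousOn q (Icc 0 t) := fun τ hτ =>
    (hq τ hτ.1).continuousWithinAt.mono Icc_subset_Ici_self
  have hfc : ContinuousOn (fun τ => planarFlow β τ p) (Icc 0 t) :=
    (continuousOn_planarFlow hβ).mono Icc_subset_Ici_self
  obtain ⟨M₁, hM₁⟩ := (isCompact_Icc.image_of_continuousOn hqc).isBounded.subset_closedBall 0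
  obtain ⟨M₂, hM₂⟩ := (isCompact_Icc.image_of_continuousOn hfc).isBounded.subset_closedBall 0
  set v : Plane → Plane := fun p => (-β * (p 0 ^ 2 + p 1 ^ 2 - 1)) • p with hv
  have hvc : ContDiff ℝ 1 v := by
    rw [hv]; fun_prop
  obtain ⟨K, hK⟩ := (hvc.contDiffOn (s := Metric.closedBall (0 : Plane) (max M₁ M₂))).exists_lipschitzOnWith
    one_ne_zero (convex_closedBall _ _) (isCompact_closedBall _ _)
  refine ODE_solution_unique_of_mem_Icc_right (v := fun _ => v)
    (s := fun _ => Metric.closedBall (0 : Plane) (max M₁ M₂)) (K := K) (fun _ _ => hK)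
    hqc (fun τ hτ => (hq τ hτ.1).mono (Ici_subset_Ici.2 hτ.1)) (fun τ hτ => ?_)
    hfc (fun τ hτ => (hasDerivAt_planarFlow (flowDen_pos hβ (sq_nonneg _) hτ.1)).hasDerivWithinAt)
    (fun τ hτ => ?_) (by rw [h0, planarFlow_zero_time]) ⟨ht, le_rfl⟩
  · exact Metric.closedBall_subset_closedBall (le_max_left _ _)
      (hM₁ (mem_image_of_mem _ (Ico_subset_Icc_self hτ)))
  · exact Metric.closedBall_subset_closedBall (le_max_right _ _)
      (hM₂ (mem_image_of_mem _ (Ico_subset_Icc_self hτ)))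

end PlanarFlow

/-! ### The scalar equation on a ray. -/

section Profiles

open MeasureTheory

/-- The value at radius `R` of the bounded complete solution of `k' = -l k + θ(R(t))`. -/
def profile (β l : ℝ) (θ : ℝ → ℝ) (R : ℝ) : ℝ :=
  ∫ u in Iic (0 : ℝ), Real.exp (l * u) * θ (radialFlow β u R)

/-- The solution of `k' = -l k + θ(R(t))`, `k(0) = 0`. -/
def duhamel (β l : ℝ) (θ : ℝ → ℝ) (t R : ℝ) : ℝ :=
  Real.exp (-(l * t)) * ∫ u in (0 : ℝ)..t, Real.exp (l * u) * θ (radialFlow β (max u 0) R)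

variable {β l : ℝ} {θ : ℝ → ℝ} {M L : ℝ}

lemma duhamel_zero (R : ℝ) : duhamel β l θ 0 R = 0 := by simp [duhamel]

lemma hasDerivAt_duhamel (hβ : 0 < β) (hθ : Continuous θ) (R t : ℝ) :
    HasDerivAt (fun τ => duhamel β l θ τ R)
      (-(l * duhamel β l θ t R) + θ (radialFlow β (max t 0) R)) t := by
  -- Freezing the orbit at negative times makes the integrand continuous on the whole line, even for
  -- `R > 1`.
  have hc : Continuous fun u => Real.exp (l * u) * θ (radialFlow β (max u 0) R) :=
    (by fun_prop : Continuous fun u => Real.exp (l * u)).mul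
      (hθ.comp (continuous_radialFlow_max hβ R))
  have h1 := (hc.integral_hasStrictDerivAt 0 t).hasDerivAt
  have h2 := ((hasDerivAt_id t).const_mul l).neg.exp
  refine (h2.mul h1).congr_deriv ?_
  have h3 : Real.exp (-(l * t)) * Real.exp (l * t) = 1 := by rw [← Real.exp_add]; simp
  simp only [duhamel, id, mul_one, ← mul_assoc, Pi.neg_apply]
  rw [h3]; ring

lemma integrableOn_profile (hl : 0 < l) (hθ : Continuous θ) (hM : ∀ x, |θ x| ≤ M) {R : ℝ}
    (hR : R ∈ Icc (0 : ℝ) 1) (c : ℝ) :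
    IntegrableOn (fun u => Real.exp (l * u) * θ (radialFlow β u R)) (Iic c) := by
  have hc : Continuous fun u => Real.exp (l * u) * θ (radialFlow β u R) :=
    (by fun_prop : Continuous fun u => Real.exp (l * u)).mul (hθ.comp (continuous_radialFlow hR))
  refine Integrable.mono' ((integrableOn_exp_mul_Iic hl c).mul_const M)
    hc.aestronglyMeasurable (Eventually.of_forall fun u => ?_)
  rw [norm_mul, Real.norm_eq_abs, abs_of_pos (Real.exp_pos _)]
  exact mul_le_mul_of_nonneg_left (hM _) (Real.exp_pos _).le

lemma profile_zero (h0 : θ 0 = 0) : profile β l θ 0 = 0 := by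
  simp [profile, radialFlow_zero, h0]

lemma profile_one (hl : 0 < l) (h1 : θ 1 = 1) : profile β l θ 1 = 1 / l := by
  simp [profile, radialFlow_one, h1, integral_exp_mul_Iic hl]

/-- Shifting time by `t` turns the left side into an integral over `(-∞, t]`, which is split at `0`.
The invariance of the attractor rests on this identity. -/
lemma profile_radialFlow (hl : 0 < l) (hθ : Continuous θ) (hM : ∀ x, |θ x| ≤ M) {R : ℝ}
    (hR : R ∈ Icc (0 : ℝ) 1) {t : ℝ} (ht : 0 ≤ t) :
    profile β l θ (radialFlow β t R) =
      Real.exp (-(l * t)) * profile β l θ R + duhamel β l θ t R := by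
  set f : ℝ → ℝ := fun u => Real.exp (l * u) * θ (radialFlow β u R) with hf
  have h1 : profile β l θ (radialFlow β t R) = Real.exp (-(l * t)) * ∫ u in Iic t, f u := by
    have h2 := (measurePreserving_add_right (volume : Measure ℝ) t).setIntegral_preimage_emb
      (MeasurableEquiv.addRight t).measurableEmbedding f (Iic t)
    rw [← h2, ← integral_const_mul]
    have h3 : (fun x => x + t) ⁻¹' Iic t = Iic (0 : ℝ) := by ext x; simp
    rw [h3, profile]
    refine setIntegral_congr_fun measurableSet_Iic fun u _ => ?_
    simp only [hf]
    rw [radialFlow_radialFlow (flowDen_pos_of_le_one (sq_nonneg R) (sq_le_one_of_mem hR)),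
      ← mul_assoc, ← Real.exp_add]
    ring_nf
  have h4 := intervalIntegral.integral_Iic_sub_Iic (integrableOn_profile (β := β) hl hθ hM hR 0)
    (integrableOn_profile (β := β) hl hθ hM hR t)
  have h5 : ∫ u in (0 : ℝ)..t, f u =
      ∫ u in (0 : ℝ)..t, Real.exp (l * u) * θ (radialFlow β (max u 0) R) := by
    refine intervalIntegral.integral_congr fun u hu => ?_
    rw [uIcc_of_le ht] at hu
    simp only [hf, max_eq_left hu.1]
  rw [h1, duhamel, ← h5, ← mul_add, ← h4]
  simp only [profile, hf]
  ring

/-- The profiles are Lipschitz on `[0, 1]` with a constant of order `1 / l`. -/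
lemma abs_profile_sub_le (hβ : 0 < β) (hβl : 4 * β ≤ l) (hθ : Continuous θ)
    (hM : ∀ x, |θ x| ≤ M) (hL : ∀ x y, |θ x - θ y| ≤ L * |x - y|) {R R' : ℝ}
    (hR : R ∈ Icc (0 : ℝ) 1) (hR' : R' ∈ Icc (0 : ℝ) 1) :
    |profile β l θ R - profile β l θ R'| ≤ 2 * L / l * |R - R'| := by
  have hl : 0 < l := by linarith
  have hL0 : 0 ≤ L := by simpa using (abs_nonneg _).trans (hL 1 0)
  -- Integrating the decay against the backward expansion gives `1 / (l - 2β)`, which is at most `2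
  -- / l` because `4β ≤ l`.
  have hl' : 0 < l - 2 * β := by linarith
  rw [profile, profile, ← integral_sub (integrableOn_profile hl hθ hM hR 0)
    (integrableOn_profile hl hθ hM hR' 0)]
  rw [← Real.norm_eq_abs]
  refine (norm_integral_le_of_norm_le (g := fun u => Real.exp ((l - 2 * β) * u) * (L * |R - R'|))
    ((integrableOn_exp_mul_Iic hl' 0).mul_const (L * |R - R'|)) ?_).trans ?_
  · refine (ae_restrict_iff' measurableSet_Iic).2 (Eventually.of_forall fun u hu => ?_)
    rw [← mul_sub, norm_mul, Real.norm_eq_abs, Real.norm_eq_abs, abs_of_pos (Real.exp_pos _)]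
    have h1 : Real.exp ((l - 2 * β) * u) = Real.exp (l * u) * Real.exp (-(2 * β * u)) := by
      rw [← Real.exp_add]; ring_nf
    rw [h1, mul_assoc]
    refine mul_le_mul_of_nonneg_left ?_ (Real.exp_pos _).le
    refine (hL _ _).trans ?_
    have := mul_le_mul_of_nonneg_left (abs_radialFlow_sub_le hβ hu hR hR') hL0
    linarith
  · rw [integral_mul_const, integral_exp_mul_Iic hl', mul_zero, Real.exp_zero, ← mul_assoc]
    refine mul_le_mul_of_nonneg_right ?_ (abs_nonneg _)
    rw [div_mul_eq_mul_div, one_mul, div_le_div_iff₀ hl' hl]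
    nlinarith

lemma abs_profile_le (hβ : 0 < β) (hβl : 4 * β ≤ l) (hθ : Continuous θ)
    (hM : ∀ x, |θ x| ≤ M) (hL : ∀ x y, |θ x - θ y| ≤ L * |x - y|) (h0 : θ 0 = 0) {R : ℝ}
    (hR : R ∈ Icc (0 : ℝ) 1) : |profile β l θ R| ≤ 2 * L / l * R := by
  have := abs_profile_sub_le hβ hβl hθ hM hL hR (left_mem_Icc.2 zero_le_one)
  rwa [profile_zero h0, sub_zero, sub_zero, abs_of_nonneg hR.1] at this

/-- Outside the unit disk the Duhamel terms approach those of the unit circle. -/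
lemma abs_duhamel_sub_le (hβ : 0 < β) (hβl : 4 * β ≤ l) (hθ : Continuous θ)
    (hL : ∀ x y, |θ x - θ y| ≤ L * |x - y|) {R t : ℝ} (hR : 1 ≤ R) (ht : 0 ≤ t) :
    |duhamel β l θ t R - duhamel β l θ t 1| ≤ 2 * L / l * R ^ 2 * Real.exp (-(2 * β * t)) := by
  have hl : 0 < l := by linarith
  have hL0 : 0 ≤ L := by simpa using (abs_nonneg _).trans (hL 1 0)
  have hl' : 0 < l - 2 * β := by linarith
  have hc : ∀ R, Continuous fun u => Real.exp (l * u) * θ (radialFlow β (max u 0) R) := fun R =>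
    (by fun_prop : Continuous fun u => Real.exp (l * u)).mul
      (hθ.comp (continuous_radialFlow_max hβ R))
  rw [duhamel, duhamel, ← mul_sub, ← intervalIntegral.integral_sub
    ((hc R).intervalIntegrable _ _) ((hc 1).intervalIntegrable _ _), abs_mul,
    abs_of_pos (Real.exp_pos _)]
  have h1 : |∫ u in (0 : ℝ)..t, (Real.exp (l * u) * θ (radialFlow β (max u 0) R) -
      Real.exp (l * u) * θ (radialFlow β (max u 0) 1))| ≤
      ∫ u in (0 : ℝ)..t, L * R ^ 2 * Real.exp ((l - 2 * β) * u) := by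
    rw [← Real.norm_eq_abs]
    refine intervalIntegral.norm_integral_le_of_norm_le ht (Eventually.of_forall fun u hu => ?_)
      ((by fun_prop : Continuous fun u => L * R ^ 2 * Real.exp ((l - 2 * β) * u)).intervalIntegrable
        _ _)
    rw [← mul_sub, norm_mul, Real.norm_eq_abs, Real.norm_eq_abs, abs_of_pos (Real.exp_pos _),
      radialFlow_one, max_eq_left hu.1.le]
    have h2 : Real.exp ((l - 2 * β) * u) = Real.exp (l * u) * Real.exp (-(2 * β * u)) := by
      rw [← Real.exp_add]; ring_nf
    have h3 := (hL (radialFlow β u R) 1).trans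
      (mul_le_mul_of_nonneg_left (abs_radialFlow_sub_one_le hβ hu.1.le hR) hL0)
    have h4 := mul_le_mul_of_nonneg_left h3 (Real.exp_pos (l * u)).le
    rw [h2]; linarith
  have h5 : ∫ u in (0 : ℝ)..t, L * R ^ 2 * Real.exp ((l - 2 * β) * u) =
      L * R ^ 2 * ((Real.exp ((l - 2 * β) * t) - 1) / (l - 2 * β)) := by
    rw [intervalIntegral.integral_const_mul,
      intervalIntegral.integral_comp_mul_left (fun x => Real.exp x) hl'.ne', integral_exp]
    simp [div_eq_inv_mul]
  rw [h5] at h1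
  have h6 : Real.exp (-(l * t)) * Real.exp ((l - 2 * β) * t) = Real.exp (-(2 * β * t)) := by
    rw [← Real.exp_add]; ring_nf
  calc _ ≤ Real.exp (-(l * t)) * (L * R ^ 2 * ((Real.exp ((l - 2 * β) * t) - 1) / (l - 2 * β))) :=
        mul_le_mul_of_nonneg_left h1 (Real.exp_pos _).le
    _ ≤ Real.exp (-(l * t)) * (L * R ^ 2 * (Real.exp ((l - 2 * β) * t) / (l - 2 * β))) := by
        gcongr; linarith
    _ = L / (l - 2 * β) * (R ^ 2 * Real.exp (-(2 * β * t))) := by rw [← h6]; ring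
    _ ≤ 2 * L / l * (R ^ 2 * Real.exp (-(2 * β * t))) := by
        refine mul_le_mul_of_nonneg_right ?_ (by positivity)
        rw [div_le_div_iff₀ hl' hl]
        nlinarith
    _ = _ := by ring

end Profiles

/-! ### The solution semigroup and its global attractor. -/

section Dynamics

/-- The properties of the coefficients that the construction of the attractor relies on. -/
structure IsSectorData (lam B : ℕ → ℝ) (θ : ℝ → ℝ) (ψ : ℕ → ℝ → ℝ) (M L C b : ℝ) : Prop where
  lam_pos : ∀ n, 0 < lam n
  lam_mono : Monotone lam
  sparse : IsSparse ψ
  cont : Continuous θ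
  bound : ∀ x, |θ x| ≤ M
  lip : ∀ x y, |θ x - θ y| ≤ L * |x - y|
  zero : θ 0 = 0
  one : θ 1 = 1
  bound_ψ : ∀ n x, |ψ n x| ≤ C
  bound_B : ∀ n, |B n| ≤ b

/-- The coefficients of the bounded complete trajectories. -/
def trajCoef (lam B : ℕ → ℝ) (θ : ℝ → ℝ) (ψ : ℕ → ℝ → ℝ) (β : ℝ) (n : ℕ) (p : Plane) : ℝ :=
  β * B n * profile β (lam n) θ ‖p‖ * ψ n (polarAngle p)

/-- The coefficients of the solution with zero initial value. -/
def duhamelCoef (lam B : ℕ → ℝ) (θ : ℝ → ℝ) (ψ : ℕ → ℝ → ℝ) (β t : ℝ) (n : ℕ) (p : Plane) : ℝ :=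
  β * B n * duhamel β (lam n) θ t ‖p‖ * ψ n (polarAngle p)

variable {H : Type*} [NormedAddCommGroup H] [InnerProductSpace ℝ H]

/-- The solution semigroup. -/
def sectorFlow (e : HilbertBasis ℕ ℝ H) (lam B : ℕ → ℝ) (θ : ℝ → ℝ) (ψ : ℕ → ℝ → ℝ) (β t : ℝ)
    (u : Plane × H) : Plane × H :=
  (planarFlow β t u.1, heat e lam t u.2 + sparseSum e (duhamelCoef lam B θ ψ β t) u.1)

/-- The global attractor, a graph over the closed unit disk. -/
def sectorAttractor (e : HilbertBasis ℕ ℝ H) (lam B : ℕ → ℝ) (θ : ℝ → ℝ) (ψ : ℕ → ℝ → ℝ) (β : ℝ) :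
    Set (Plane × H) :=
  (fun p => (p, sparseSum e (trajCoef lam B θ ψ β) p)) '' Metric.closedBall 0 1

variable {e : HilbertBasis ℕ ℝ H} {lam B : ℕ → ℝ} {θ : ℝ → ℝ} {ψ : ℕ → ℝ → ℝ} {M L C b β : ℝ}

lemma isSparse_trajCoef (hψ : IsSparse ψ) : IsSparse (trajCoef lam B θ ψ β) := fun p =>
  (hψ (polarAngle p)).imp fun n hn m hm => by rw [trajCoef, hn m hm, mul_zero]

/-- The angle is constant along the orbit, so the forcing acts on one mode `n` fixed by the initial
point. -/
lemma isForwardSolution_sectorFlow [CompleteSpace H] {A : H →ₗ.[ℝ] H} (hA : IsSelfAdjoint A)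
    (hAe : ∀ n, ∃ h : e n ∈ A.domain, A ⟨e n, h⟩ = lam n • e n)
    (hd : IsSectorData lam B θ ψ M L C b) (hβ : 0 < β) (u₀ : Plane × H) :
    IsForwardSolution A (sectorMap e B θ ψ) β (fun t => sectorFlow e lam B θ ψ β t u₀) := by
  obtain ⟨p, v⟩ := u₀
  obtain ⟨n, hn⟩ := hd.sparse (polarAngle p)
  have hD : ∀ t, sparseSum e (duhamelCoef lam B θ ψ β t) p = duhamelCoef lam B θ ψ β t n p • e n :=
    fun t => sparseSum_eq fun m hm => by rw [duhamelCoef, hn m hm, mul_zero]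
  have hDd : ∀ t, HasDerivAt (fun τ => duhamelCoef lam B θ ψ β τ n p)
      (β * B n * (-(lam n * duhamel β (lam n) θ t ‖p‖) + θ (radialFlow β (max t 0) ‖p‖)) *
        ψ n (polarAngle p)) t := fun t =>
    ((hasDerivAt_duhamel hβ hd.cont ‖p‖ t).const_mul (β * B n)).mul_const _
  refine ⟨?_, fun t ht => ?_, fun w t ht => ?_⟩
  · simp only [sectorFlow, hD]
    refine (continuousOn_planarFlow hβ).prodMk ((continuousOn_heat hd.lam_pos v).add ?_)
    exact (continuous_iff_continuousAt.2 fun t => (hDd t).continuousAt).continuousOn.smul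
      continuousOn_const
  · exact (hasDerivAt_planarFlow (flowDen_pos hβ (sq_nonneg _) ht)).hasDerivWithinAt
  · simp only [sectorFlow, hD, inner_add_right, inner_smul_right]
    have hden := flowDen_pos hβ (sq_nonneg ‖p‖) ht
    have hF : sectorMap e B θ ψ (planarFlow β t p) =
        (B n * θ (radialFlow β t ‖p‖) * ψ n (polarAngle p)) • e n := by
      rw [sectorMap, tsum_eq_single n, norm_planarFlow, polarAngle_planarFlow hden]
      intro m hm
      rw [polarAngle_planarFlow hden, hn m hm, mul_zero, zero_smul]
    have hAw : ⟪A w, e n⟫_ℝ = lam n * ⟪(w : H), e n⟫_ℝ := by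
      rw [real_inner_comm, inner_basis_apply hA hAe, real_inner_comm]
    refine ((hasDerivWithinAt_inner_heat hd.lam_pos (inner_basis_apply hA hAe w) v ht).add
      ((hDd t).hasDerivWithinAt.mul_const ⟪(w : H), e n⟫_ℝ)).congr_deriv ?_
    rw [hF, inner_smul_right, hAw, max_eq_left ht, duhamelCoef]
    ring

theorem isSolutionSemigroup_sectorFlow [CompleteSpace H] {A : H →ₗ.[ℝ] H} (hA : IsSelfAdjoint A)
    (hAe : ∀ n, ∃ h : e n ∈ A.domain, A ⟨e n, h⟩ = lam n • e n)
    (hd : IsSectorData lam B θ ψ M L C b) (hβ : 0 < β) :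
    IsSolutionSemigroup A (sectorMap e B θ ψ) β (sectorFlow e lam B θ ψ β) := by
  intro u₀
  have hS0 : sectorFlow e lam B θ ψ β 0 u₀ = u₀ := by
    have : sparseSum e (duhamelCoef lam B θ ψ β 0) u₀.1 = 0 := by
      simp [sparseSum, duhamelCoef, duhamel_zero]
    rw [sectorFlow, planarFlow_zero_time, heat_zero hd.lam_pos, this, add_zero]
  have hS := isForwardSolution_sectorFlow hA hAe hd hβ u₀
  refine ⟨hS0, hS, fun u hu hu0 => ?_⟩
  have hplanar : ∀ t : ℝ, 0 ≤ t → (u t).1 = planarFlow β t u₀.1 := fun t ht =>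
    planar_unique hβ hu.planar (by rw [hu0]) ht
  intro t ht
  refine Prod.ext (hplanar t ht) (e.ext_inner fun n => ?_)
  obtain ⟨hn, -⟩ := hAe n
  -- Integrating factor for the `n`-th coefficient of the difference. The planar components agree,
  -- so the forcing cancels and `z` is constant.
  set z : ℝ → ℝ := fun τ => Real.exp (lam n * τ) *
    (⟪e n, (u τ).2⟫_ℝ - ⟪e n, (sectorFlow e lam B θ ψ β τ u₀).2⟫_ℝ) with hz
  have hzd : ∀ τ : ℝ, 0 ≤ τ → HasDerivWithinAt z 0 (Ici 0) τ := by
    intro τ hτ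
    have h1 := (hu.weak ⟨e n, hn⟩ τ hτ).sub (hS.weak ⟨e n, hn⟩ τ hτ)
    have h2 := (((hasDerivAt_id τ).const_mul (lam n)).exp.hasDerivWithinAt (s := Ici 0)).mul h1
    refine h2.congr_deriv ?_
    have h3 : (u τ).1 = (sectorFlow e lam B θ ψ β τ u₀).1 := hplanar τ hτ
    have h4 : A ⟨e n, hn⟩ = lam n • e n := (hAe n).choose_spec
    simp only [h3, h4, real_inner_smul_left, id, Pi.sub_apply]
    ring
  have hconst := constant_of_has_deriv_right_zero (f := z) (a := 0) (b := t)
    (fun τ hτ => (hzd τ hτ.1).continuousWithinAt.mono Icc_subset_Ici_self)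
    (fun τ hτ => (hzd τ hτ.1).mono (Ici_subset_Ici.2 hτ.1)) t ⟨ht, le_rfl⟩
  have hz0 : z 0 = 0 := by simp [hz, hS0, hu0]
  rw [hz0, hz] at hconst
  exact sub_eq_zero.1 ((mul_eq_zero.1 hconst).resolve_left (Real.exp_pos _).ne')

lemma norm_mem_Icc {p : Plane} (hp : p ∈ Metric.closedBall (0 : Plane) 1) :
    ‖p‖ ∈ Icc (0 : ℝ) 1 := ⟨norm_nonneg _, by simpa using hp⟩

lemma sectorFlow_traj (hd : IsSectorData lam B θ ψ M L C b) {t : ℝ} (ht : 0 ≤ t) {p : Plane}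
    (hp : p ∈ Metric.closedBall (0 : Plane) 1) :
    sectorFlow e lam B θ ψ β t (p, sparseSum e (trajCoef lam B θ ψ β) p) =
      (planarFlow β t p, sparseSum e (trajCoef lam B θ ψ β) (planarFlow β t p)) := by
  obtain ⟨n, hn⟩ := hd.sparse (polarAngle p)
  have hden := flowDen_pos_of_le_one (β := β) (t := t) (sq_nonneg ‖p‖)
    (sq_le_one_of_mem (norm_mem_Icc hp))
  have hang := polarAngle_planarFlow hden
  refine Prod.ext rfl ?_
  simp only [sectorFlow]
  rw [sparseSum_eq (T := trajCoef lam B θ ψ β) (p := p) (n := n)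
      fun m hm => by rw [trajCoef, hn m hm, mul_zero],
    sparseSum_eq (T := duhamelCoef lam B θ ψ β t) (p := p) (n := n)
      fun m hm => by rw [duhamelCoef, hn m hm, mul_zero],
    sparseSum_eq (T := trajCoef lam B θ ψ β) (p := planarFlow β t p) (n := n)
      fun m hm => by rw [trajCoef, hang, hn m hm, mul_zero],
    heat_smul_basis hd.lam_pos ht, ← add_smul]
  congr 1
  rw [trajCoef, trajCoef, duhamelCoef, hang, norm_planarFlow,
    profile_radialFlow (hd.lam_pos n) hd.cont hd.bound (norm_mem_Icc hp) ht]
  ring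

lemma planarFlow_mem {p : Plane} (hp : p ∈ Metric.closedBall (0 : Plane) 1) (t : ℝ) :
    planarFlow β t p ∈ Metric.closedBall (0 : Plane) 1 := by
  rw [mem_closedBall_zero_iff, norm_planarFlow]
  exact (radialFlow_mem (norm_mem_Icc hp)).2

lemma sectorFlow_image_attractor (hd : IsSectorData lam B θ ψ M L C b) {t : ℝ} (ht : 0 ≤ t) :
    sectorFlow e lam B θ ψ β t '' sectorAttractor e lam B θ ψ β =
      sectorAttractor e lam B θ ψ β := by
  apply Subset.antisymm
  · rintro _ ⟨_, ⟨p, hp, rfl⟩, rfl⟩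
    exact ⟨planarFlow β t p, planarFlow_mem hp t, (sectorFlow_traj hd ht hp).symm⟩
  · rintro _ ⟨p, hp, rfl⟩
    -- Strict invariance: preimages come from the backward flow, which keeps the disk.
    have hden := flowDen_pos_of_le_one (β := β) (t := -t) (sq_nonneg ‖p‖)
      (sq_le_one_of_mem (norm_mem_Icc hp))
    have h1 : planarFlow β t (planarFlow β (-t) p) = p := by
      rw [planarFlow_planarFlow hden, add_neg_cancel, planarFlow_zero_time]
    refine ⟨_, ⟨planarFlow β (-t) p, planarFlow_mem hp _, rfl⟩, ?_⟩
    rw [sectorFlow_traj hd ht (planarFlow_mem hp _), h1]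

lemma abs_trajCoef_le (hd : IsSectorData lam B θ ψ M L C b) (hβ : 0 < β) (hβl : 4 * β ≤ lam 0)
    (n : ℕ) {p : Plane} (hp : p ∈ Metric.closedBall (0 : Plane) 1) :
    |trajCoef lam B θ ψ β n p| ≤ β * |B n| * (2 * L / lam n) * C := by
  have hL0 : 0 ≤ L := by simpa using (abs_nonneg _).trans (hd.lip 1 0)
  have hC0 : 0 ≤ C := (abs_nonneg _).trans (hd.bound_ψ 0 0)
  have hn := hd.lam_pos n
  have h1 := abs_profile_le hβ (hβl.trans (hd.lam_mono (Nat.zero_le n))) hd.cont hd.bound hd.lip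
    hd.zero (norm_mem_Icc hp)
  rw [trajCoef, abs_mul, abs_mul, abs_mul, abs_of_pos hβ]
  refine mul_le_mul (mul_le_mul_of_nonneg_left (h1.trans ?_) (by positivity)) (hd.bound_ψ _ _)
    (abs_nonneg _) (by positivity)
  exact mul_le_of_le_one_right (by positivity) (norm_mem_Icc hp).2

theorem isGlobalAttractor_sectorAttractor (hd : IsSectorData lam B θ ψ M L C b) (hβ : 0 < β)
    (hβl : 4 * β ≤ lam 0) (hK : IsCompact (sectorAttractor e lam B θ ψ β)) :
    IsGlobalAttractor (sectorFlow e lam B θ ψ β) (sectorAttractor e lam B θ ψ β) := by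
  refine ⟨hK, fun t ht => sectorFlow_image_attractor hd ht, fun D hD ε hε => ?_⟩
  have hL0 : 0 ≤ L := by simpa using (abs_nonneg _).trans (hd.lip 1 0)
  have hC0 : 0 ≤ C := (abs_nonneg _).trans (hd.bound_ψ 0 0)
  have hb0 : 0 ≤ b := (abs_nonneg _).trans (hd.bound_B 0)
  have hl0 := hd.lam_pos 0
  obtain ⟨N, hN⟩ := hD.exists_norm_le
  set N' := max N 1 with hN'
  set Q := β * b * (2 * L / lam 0) * C with hQ
  have hQ0 : 0 ≤ Q := by positivity
  have hQn : ∀ n, β * |B n| * (2 * L / lam n) * C ≤ Q := by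
    intro n
    have h1 := hd.lam_mono (Nat.zero_le n)
    have h2 := hd.bound_B n
    have h3 : 0 ≤ 2 * L / lam n := div_nonneg (by positivity) (hd.lam_pos n).le
    rw [hQ]; gcongr
  -- `N'²` bounds the planar error, `N' + Q` the initial distance in `H` to the graph, and `Q N'²`
  -- the Duhamel error. All decay at least like `exp (-2βt)`, the heat part because `4β ≤ λ₀`.
  set Z := N' ^ 2 + (N' + Q + Q * N' ^ 2) with hZ
  have hlim : Tendsto (fun t => Z * Real.exp (-(2 * β * t))) atTop (𝓝 (Z * 0)) := by
    refine Tendsto.const_mul _ (Real.tendsto_exp_neg_atTop_nhds_zero.comp ?_)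
    exact tendsto_id.const_mul_atTop (by positivity)
  rw [mul_zero] at hlim
  obtain ⟨T, hT⟩ := eventually_atTop.1 (hlim.eventually (gt_mem_nhds hε))
  refine ⟨T, fun t htT ht => ?_⟩
  rintro _ ⟨⟨p, v⟩, hpv, rfl⟩
  have hN1 : ‖p‖ ≤ N' := (norm_fst_le (p, v)).trans ((hN _ hpv).trans (le_max_left _ _))
  have hN2 : ‖v‖ ≤ N' := (norm_snd_le (p, v)).trans ((hN _ hpv).trans (le_max_left _ _))
  have hN'1 : 1 ≤ N' := le_max_right _ _
  set E := Real.exp (-(2 * β * t)) with hE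
  have hE0 : 0 < E := Real.exp_pos _
  -- the radial projection of `p` onto the disk
  obtain ⟨q, hq, hpq1, hpq2⟩ : ∃ q ∈ Metric.closedBall (0 : Plane) 1,
      ‖planarFlow β t p - planarFlow β t q‖ ≤ N' ^ 2 * E ∧
      ‖sparseSum e (duhamelCoef lam B θ ψ β t) p - sparseSum e (duhamelCoef lam B θ ψ β t) q‖ ≤
        Q * N' ^ 2 * E := by
    rcases le_or_gt ‖p‖ 1 with h | h
    · refine ⟨p, by simpa using h, ?_, ?_⟩ <;> rw [sub_self, norm_zero] <;> positivity
    · have hp0 : 0 < ‖p‖ := zero_lt_one.trans h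
      have hsq : ‖p‖ ^ 2 ≤ N' ^ 2 := pow_le_pow_left₀ hp0.le hN1 2
      set q := ‖p‖⁻¹ • p with hqdef
      have hq1 : ‖q‖ = 1 := by
        rw [hqdef, norm_smul, norm_inv, norm_norm, inv_mul_cancel₀ hp0.ne']
      have hang : polarAngle q = polarAngle p := polarAngle_smul (inv_pos.2 hp0) p
      refine ⟨q, by simp [hq1], ?_, ?_⟩
      · have h1 : planarFlow β t p = radialFlow β t ‖p‖ • q := by
          rw [hqdef, smul_smul, planarFlow, radialFlow]
          congr 1; field_simp
        have h2 : planarFlow β t q = q := by simp [planarFlow, hq1, flowDen]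
        have h3 : radialFlow β t ‖p‖ • q - q = (radialFlow β t ‖p‖ - 1) • q := by
          rw [sub_smul, one_smul]
        rw [h1, h2, h3, norm_smul, hq1, mul_one, Real.norm_eq_abs]
        exact (abs_radialFlow_sub_one_le hβ ht h.le).trans
          (mul_le_mul_of_nonneg_right hsq hE0.le)
      · obtain ⟨n, hn⟩ := hd.sparse (polarAngle p)
        rw [sparseSum_eq (p := p) (n := n) fun m hm => by rw [duhamelCoef, hn m hm, mul_zero],
          sparseSum_eq (p := q) (n := n) fun m hm => by rw [duhamelCoef, hang, hn m hm, mul_zero],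
          ← sub_smul, norm_smul_basis, duhamelCoef, duhamelCoef, hang, hq1, ← sub_mul, ← mul_sub,
          abs_mul, abs_mul, abs_mul, abs_of_pos hβ]
        have h1 := abs_duhamel_sub_le hβ (hβl.trans (hd.lam_mono (Nat.zero_le n))) hd.cont hd.lip
          h.le ht
        have hn0 := hd.lam_pos n
        calc β * |B n| * |duhamel β (lam n) θ t ‖p‖ - duhamel β (lam n) θ t 1| *
              |ψ n (polarAngle p)|
            ≤ β * |B n| * (2 * L / lam n * ‖p‖ ^ 2 * E) * C :=
              mul_le_mul (mul_le_mul_of_nonneg_left h1 (by positivity)) (hd.bound_ψ _ _)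
                (abs_nonneg _) (by positivity)
          _ = (β * |B n| * (2 * L / lam n) * C) * (‖p‖ ^ 2 * E) := by ring
          _ ≤ Q * (N' ^ 2 * E) := by
              refine mul_le_mul (hQn n) ?_ (by positivity) hQ0
              exact mul_le_mul_of_nonneg_right hsq hE0.le
          _ = _ := by ring
  rw [Metric.mem_thickening_iff]
  refine ⟨_, ⟨planarFlow β t q, planarFlow_mem hq t, rfl⟩, ?_⟩
  dsimp only
  rw [← sectorFlow_traj hd ht hq]
  refine lt_of_le_of_lt ?_ (hT t htT)
  have hG : ‖sparseSum e (trajCoef lam B θ ψ β) q‖ ≤ Q :=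
    (isSparse_trajCoef hd.sparse).norm_sparseSum_le fun n =>
      (abs_trajCoef_le hd hβ hβl n hq).trans (hQn n)
  have hheat : ‖heat e lam t v - heat e lam t (sparseSum e (trajCoef lam B θ ψ β) q)‖ ≤
      (N' + Q) * E := by
    rw [← heat_sub hd.lam_pos ht]
    refine (norm_heat_le hd.lam_pos hd.lam_mono ht _).trans ?_
    rw [mul_comm]
    refine mul_le_mul ((norm_sub_le _ _).trans (add_le_add hN2 hG)) ?_ (Real.exp_pos _).le
      (by positivity)
    rw [hE, Real.exp_le_exp]
    nlinarith
  rw [Prod.dist_eq]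
  refine max_le ?_ ?_
  · rw [dist_eq_norm]
    refine hpq1.trans (mul_le_mul_of_nonneg_right ?_ hE0.le)
    rw [hZ]
    have : 0 ≤ N' + Q + Q * N' ^ 2 := by positivity
    linarith
  · rw [dist_eq_norm]
    simp only [sectorFlow]
    rw [add_sub_add_comm]
    refine (norm_add_le _ _).trans ((add_le_add hheat hpq2).trans ?_)
    rw [← add_mul]
    refine mul_le_mul_of_nonneg_right ?_ hE0.le
    rw [hZ]
    have : 0 ≤ N' ^ 2 := by positivity
    linarith

end Dynamics

/-! ### Compactness and dimension of the attractor in `ℝ² × H^s`. -/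

section Dimension

open Metric

lemma card_le_externalCoveringNumber {X ι : Type*} [PseudoMetricSpace X] {K : Set X} {ε : ℝ≥0}
    {t : Finset ι} {f : ι → X} (hf : ∀ i ∈ t, f i ∈ K)
    (hsep : ∀ i ∈ t, ∀ j ∈ t, i ≠ j → 2 * (ε : ℝ) < dist (f i) (f j)) :
    (t.card : ℕ∞) ≤ externalCoveringNumber ε K := by
  refine le_trans ?_ (packingNumber_two_mul_le_externalCoveringNumber ε K)
  have hinj : InjOn f t := by
    intro i hi j hj hij
    by_contra hne
    have h1 := hsep i hi j hj hne
    rw [hij, dist_self] at h1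
    linarith [ε.coe_nonneg]
  rw [← Set.encard_coe_eq_coe_finsetCard, ← hinj.encard_image]
  refine IsSeparated.encard_le_packingNumber ?_ ?_
  · rintro _ ⟨i, hi, rfl⟩
    exact hf i hi
  · rintro _ ⟨i, hi, rfl⟩ _ ⟨j, hj, rfl⟩ hne
    have h1 := hsep i hi j hj fun h => hne (by rw [h])
    rw [edist_dist, ENNReal.lt_ofReal_iff_toReal_lt ENNReal.coe_ne_top]
    simpa using h1

variable {H : Type*} [NormedAddCommGroup H] [InnerProductSpace ℝ H]
variable {e : HilbertBasis ℕ ℝ H} {lam B : ℕ → ℝ} {θ : ℝ → ℝ} {ψ : ℕ → ℝ → ℝ} {M L C b β : ℝ}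

lemma le_dist_smul_basis {n m : ℕ} (hnm : n ≠ m) (x y : ℝ) : |x| ≤ dist (x • e n) (y • e m) := by
  rw [dist_eq_norm]
  have h := abs_real_inner_le_norm (e n) (x • e n - y • e m)
  rw [inner_sub_right, inner_smul_right, inner_smul_right, e.inner_self_ite, e.inner_self_ite,
    if_pos rfl, if_neg hnm, mul_one, mul_zero, sub_zero, e.orthonormal.1, one_mul] at h
  exact h

/-- Segments of heights at least `c n ^ (-κ)` in mutually orthogonal directions force the fractal
dimension to be at least `1 + 1 / κ`. -/
theorem le_fractalDim_of_orthogonal_segments {K : Set (Plane × H)} {δ c κ : ℝ} (hδ : 0 < δ)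
    (hc : 0 < c) (hκ : 0 < κ) {w : ℕ → Plane} (hw : ∀ n, ‖w n‖ = 1) {h : ℕ → ℝ → ℝ} {N₀ : ℕ}
    (hmem : ∀ n, N₀ ≤ n → ∀ R ∈ Icc (1 - δ) 1, (R • w n, h n R • e n) ∈ K)
    (hh : ∀ n, N₀ ≤ n → ∀ R ∈ Icc (1 - δ) 1, c * (n : ℝ) ^ (-κ) ≤ h n R) :
    ((1 + 1 / κ : ℝ) : EReal) ≤ fractalDim K := by
  set N := max N₀ 1 with hN
  set c' := δ / 3 * ((c / 4) ^ (1 / κ) / 2) with hc'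
  have hc4 : 0 < (c / 4) ^ (1 / κ) := Real.rpow_pos_of_pos (by positivity) _
  refine le_fractalDim_of_le_covering (c := c') (by positivity) ?_
  -- Ensures `2N ≤ X` for the cutoff `X` below, so that at least `X/2` indices lie between `N` and
  -- `X`.
  obtain ⟨δ', hδ', hlarge⟩ := exists_le_rpow_neg (2 * N / (c / 4) ^ (1 / κ))
    (one_div_pos.2 hκ)
  filter_upwards [eventually_small hδ'] with ε hε
  have hε0 := hε.1
  -- `X` solves `c X^(-κ) = 4ε`: up to this index the heights exceed the required separation `2ε`.
  set X := (c / 4) ^ (1 / κ) * (ε : ℝ) ^ (-(1 / κ)) with hX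
  have hX2 : 2 * N ≤ X := by
    have := hlarge ε hε.1 hε.2
    rw [div_le_iff₀ hc4] at this
    rw [hX]; linarith
  have hN1 : (1 : ℝ) ≤ N := by exact_mod_cast le_max_right N₀ 1
  have hX0 : 0 < X := by linarith
  have hXκ : c * X ^ (-κ) = 4 * ε := by
    have h1 : X = (c / 4 / ε) ^ (1 / κ) := by
      rw [hX, Real.div_rpow (by positivity) hε0.le, Real.rpow_neg hε0.le, div_eq_mul_inv _ ((ε : ℝ) ^ _)]
    rw [h1, ← Real.rpow_mul (by positivity)]
    have : 1 / κ * -κ = -1 := by field_simp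
    rw [this, Real.rpow_neg_one]
    field_simp
  set J := ⌊δ / (3 * ε)⌋₊ + 1 with hJ
  set t : Finset (ℕ × ℕ) := Finset.Icc N ⌊X⌋₊ ×ˢ Finset.range J with ht
  set R : ℕ → ℝ := fun j => 1 - j * (3 * ε) with hR
  have hRmem : ∀ j ∈ Finset.range J, R j ∈ Icc (1 - δ) 1 := by
    intro j hj
    rw [Finset.mem_range, hJ, Nat.lt_add_one_iff, Nat.le_floor_iff (by positivity),
      le_div_iff₀ (by positivity)] at hj
    have : 0 ≤ (j : ℝ) * (3 * ε) := by positivity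
    constructor <;> simp only [hR] <;> linarith
  have hcard : ENNReal.ofReal (c' * (ε : ℝ) ^ (-(1 + 1 / κ))) ≤ (t.card : ℝ≥0∞) := by
    rw [← ENNReal.ofReal_natCast]
    refine ENNReal.ofReal_le_ofReal ?_
    rw [ht, Finset.card_product, Nat.card_Icc, Finset.card_range]
    push_cast
    have h1 : X / 2 ≤ ((⌊X⌋₊ + 1 - N : ℕ) : ℝ) := by
      have h2 : X < ⌊X⌋₊ + 1 := Nat.lt_floor_add_one X
      have h3 : N ≤ ⌊X⌋₊ + 1 := by
        have : (N : ℝ) ≤ ((⌊X⌋₊ + 1 : ℕ) : ℝ) := by push_cast; linarith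
        exact_mod_cast this
      rw [Nat.cast_sub h3]; push_cast; linarith
    have h4 : δ / (3 * ε) ≤ (J : ℝ) := by
      rw [hJ]; push_cast; exact (Nat.lt_floor_add_one _).le
    calc c' * (ε : ℝ) ^ (-(1 + 1 / κ)) = X / 2 * (δ / (3 * ε)) := by
          rw [hc', hX, neg_add, Real.rpow_add hε0, Real.rpow_neg_one]
          field_simp
      _ ≤ _ := mul_le_mul h1 h4 (by positivity) (by positivity)
  refine hcard.trans ?_
  have key : (t.card : ℕ∞) ≤ externalCoveringNumber ε K := by
    refine card_le_externalCoveringNumber (f := fun i => (R i.2 • w i.1, h i.1 (R i.2) • e i.1))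
      (fun i hi => ?_) (fun i hi j hj hij => ?_)
    · rw [ht, Finset.mem_product, Finset.mem_Icc] at hi
      exact hmem _ ((le_max_left _ _).trans hi.1.1) _ (hRmem _ hi.2)
    · rw [ht, Finset.mem_product, Finset.mem_Icc] at hi hj
      rw [Prod.dist_eq]
      -- Points of one segment are separated by their radii, spaced by `3ε`; points of different
      -- segments by orthogonality of the directions.
      by_cases h1 : i.1 = j.1
      · refine lt_max_of_lt_left ?_
        have h2 : i.2 ≠ j.2 := fun h2 => hij (Prod.ext h1 h2)
        simp only [h1]
        rw [dist_eq_norm, ← sub_smul, norm_smul, hw, mul_one, Real.norm_eq_abs]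
        have h3 : R i.2 - R j.2 = ((j.2 : ℤ) - (i.2 : ℤ) : ℤ) * (3 * ε) := by
          simp only [hR]; push_cast; ring
        have h4 : (1 : ℝ) ≤ |(((j.2 : ℤ) - (i.2 : ℤ) : ℤ) : ℝ)| := by
          have h5 : (j.2 : ℤ) - (i.2 : ℤ) ≠ 0 := fun h => h2 (by omega)
          rw [← Int.cast_abs, ← Int.cast_one, Int.cast_le]
          exact Int.one_le_abs h5
        rw [h3, abs_mul, abs_of_pos (a := 3 * (ε : ℝ)) (by positivity)]
        nlinarith
      · refine lt_max_of_lt_right ?_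
        refine lt_of_lt_of_le ?_ (le_dist_smul_basis h1 _ _)
        refine lt_of_lt_of_le ?_ (le_abs_self _)
        refine lt_of_lt_of_le ?_ (hh _ ((le_max_left _ _).trans hi.1.1) _ (hRmem _ hi.2))
        have hi1 : (1 : ℝ) ≤ i.1 := by exact_mod_cast (le_max_right N₀ 1).trans hi.1.1
        have h5 : (i.1 : ℝ) ≤ X := (Nat.le_floor_iff hX0.le).1 hi.1.2
        have h6 : X ^ (-κ) ≤ (i.1 : ℝ) ^ (-κ) :=
          Real.rpow_le_rpow_of_nonpos (by linarith) h5 (by linarith)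
        have h7 := mul_le_mul_of_nonneg_left h6 hc.le
        rw [hXκ] at h7
        linarith
  exact_mod_cast key

/-- The coefficients of `A^{s/2}` applied to the attractor. -/
def scaledCoef (lam B : ℕ → ℝ) (θ : ℝ → ℝ) (ψ : ℕ → ℝ → ℝ) (β s : ℝ) (n : ℕ) (p : Plane) : ℝ :=
  lam n ^ (s / 2) * trajCoef lam B θ ψ β n p

lemma isSparse_scaledCoef (hψ : IsSparse ψ) {s : ℝ} : IsSparse (scaledCoef lam B θ ψ β s) :=
  (isSparse_trajCoef hψ).const_mul _

lemma inSobolev_sectorAttractor (hψ : IsSparse ψ) (s : ℝ) :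
    inSobolev e lam s (sectorAttractor e lam B θ ψ β) =
      (fun p => (p, sparseSum e (scaledCoef lam B θ ψ β s) p)) '' closedBall 0 1 := by
  rw [inSobolev, sectorAttractor, image_image]
  refine image_congr fun p _ => ?_
  rw [(isSparse_trajCoef hψ).sobolevPow_sparseSum]
  rfl

lemma scaledCoef_eq_bump (s : ℝ) (n : ℕ) : scaledCoef lam B θ ψ β s n =
    bump (fun R => lam n ^ (s / 2) * (β * B n) * profile β (lam n) θ R) (ψ n) := by
  ext p
  rw [scaledCoef, trajCoef, bump]
  ring

lemma abs_scaledCoef_sub_le (hd : IsSectorData lam B θ ψ M L C b) (hβ : 0 < β)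
    (hβl : 4 * β ≤ lam 0) {Λ : ℕ → ℝ} (hΛ : ∀ n x y, |ψ n x - ψ n y| ≤ Λ n * |x - y|)
    (h0 : ∀ n, ψ n 0 = 0) (h2π : ∀ n, ψ n (2 * Real.pi) = 0) (s : ℝ) (n : ℕ) {p q : Plane}
    (hp : p ∈ closedBall (0 : Plane) 1) (hq : q ∈ closedBall (0 : Plane) 1) :
    |scaledCoef lam B θ ψ β s n p - scaledCoef lam B θ ψ β s n q| ≤
      lam n ^ (s / 2) * (β * |B n|) * (2 * L / lam n) * (C + 2 * Λ n) * ‖p - q‖ := by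
  have hn := Real.rpow_pos_of_pos (hd.lam_pos n) (s / 2)
  have hβn := hβl.trans (hd.lam_mono (Nat.zero_le n))
  rw [scaledCoef_eq_bump]
  refine bump_lipschitz (r := 1) (fun R hR => ?_) (fun R hR R' hR' => ?_) (hd.bound_ψ n) (hΛ n)
    (h0 n) (h2π n) (norm_mem_Icc hp).2 (norm_mem_Icc hq).2
  · rw [abs_mul, abs_mul, abs_mul, abs_of_pos hn, abs_of_pos hβ, mul_assoc _ (2 * L / lam n)]
    exact mul_le_mul_of_nonneg_left (abs_profile_le hβ hβn hd.cont hd.bound hd.lip hd.zero hR)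
      (by positivity)
  · rw [← mul_sub, abs_mul, abs_mul, abs_mul, abs_of_pos hn, abs_of_pos hβ,
      mul_assoc _ (2 * L / lam n)]
    exact mul_le_mul_of_nonneg_left (abs_profile_sub_le hβ hβn hd.cont hd.bound hd.lip hR hR')
      (by positivity)

/-- A continuous image of the disk. Only the amplitudes must vanish in the limit; the slopes may be
unbounded in `n`. -/
lemma isCompact_inSobolev_sectorAttractor (hd : IsSectorData lam B θ ψ M L C b) (hβ : 0 < β)
    (hβl : 4 * β ≤ lam 0) {Λ : ℕ → ℝ} (hΛ : ∀ n x y, |ψ n x - ψ n y| ≤ Λ n * |x - y|)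
    (h0 : ∀ n, ψ n 0 = 0) (h2π : ∀ n, ψ n (2 * Real.pi) = 0) {s : ℝ}
    (hs : Tendsto (fun n => lam n ^ (s / 2 - 1) * B n) atTop (𝓝 0)) :
    IsCompact (inSobolev e lam s (sectorAttractor e lam B θ ψ β)) := by
  rw [inSobolev_sectorAttractor hd.sparse]
  refine (isCompact_closedBall _ _).image_of_continuousOn (continuousOn_id.prodMk ?_)
  refine (isSparse_scaledCoef hd.sparse).continuousOn_sparseSum
    (b := fun n => |lam n ^ (s / 2 - 1) * B n| * (β * (2 * L) * C)) (fun n => ?_)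
    (fun n p hp => ?_) ?_
  · refine LipschitzOnWith.continuousOn (K := Real.toNNReal (lam n ^ (s / 2) * (β * |B n|) *
      (2 * L / lam n) * (C + 2 * Λ n))) (LipschitzOnWith.of_dist_le_mul fun p hp q hq => ?_)
    rw [Real.dist_eq, dist_eq_norm]
    exact (abs_scaledCoef_sub_le hd hβ hβl hΛ h0 h2π s n hp hq).trans
      (mul_le_mul_of_nonneg_right (Real.le_coe_toNNReal _) (norm_nonneg _))
  · have hn := hd.lam_pos n
    rw [scaledCoef, abs_mul, abs_of_pos (Real.rpow_pos_of_pos hn _), abs_mul,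
      abs_of_pos (Real.rpow_pos_of_pos hn _), Real.rpow_sub_one hn.ne']
    refine (mul_le_mul_of_nonneg_left (abs_trajCoef_le hd hβ hβl n hp)
      (Real.rpow_pos_of_pos hn _).le).trans (le_of_eq ?_)
    field_simp
  · have := (hs.abs).mul_const (β * (2 * L) * C)
    simpa using this

/-- The projection to the plane is 1-Lipschitz and maps onto the closed disk. -/
lemma two_le_fractalDim_inSobolev (hψ : IsSparse ψ) (s : ℝ) :
    2 ≤ fractalDim (inSobolev e lam s (sectorAttractor e lam B θ ψ β)) := by
  have h1 : Prod.fst '' inSobolev e lam s (sectorAttractor e lam B θ ψ β) =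
      closedBall (0 : Plane) 1 := by
    rw [inSobolev_sectorAttractor hψ, image_image]
    simp
  rw [← fractalDim_closedBall_plane, ← h1]
  exact (LipschitzWith.prod_fst.lipschitzOnWith).fractalDim_image_le

/-- At `s = 2` the powers of `λₙ` cancel, leaving slopes controlled by `|Bₙ|` and `|Bₙ| Λₙ`: the
graph is Lipschitz over the disk. -/
lemma fractalDim_inSobolev_two_le (hd : IsSectorData lam B θ ψ M L C b) (hβ : 0 < β)
    (hβl : 4 * β ≤ lam 0) {Λ : ℕ → ℝ} (hΛ : ∀ n x y, |ψ n x - ψ n y| ≤ Λ n * |x - y|)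
    (h0 : ∀ n, ψ n 0 = 0) (h2π : ∀ n, ψ n (2 * Real.pi) = 0) {b' : ℝ}
    (hb' : ∀ n, |B n| * Λ n ≤ b') :
    fractalDim (inSobolev e lam 2 (sectorAttractor e lam B θ ψ β)) ≤ 2 := by
  have hL0 : 0 ≤ L := by simpa using (abs_nonneg _).trans (hd.lip 1 0)
  have hC0 : 0 ≤ C := (abs_nonneg _).trans (hd.bound_ψ 0 0)
  rw [inSobolev_sectorAttractor hd.sparse, ← fractalDim_closedBall_plane]
  set D := β * (2 * L) * (b * C + 2 * b') with hD
  refine LipschitzOnWith.fractalDim_image_le (L := (max 1 (2 * D)).toNNReal)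
    (LipschitzOnWith.of_dist_le_mul fun p hp q hq => ?_)
  rw [Real.coe_toNNReal _ (by positivity), Prod.dist_eq]
  refine max_le ?_ ?_
  · exact le_mul_of_one_le_left dist_nonneg (le_max_left _ _)
  · refine le_trans ?_ (mul_le_mul_of_nonneg_right (le_max_right _ _) dist_nonneg)
    rw [dist_eq_norm, dist_eq_norm, mul_assoc]
    refine (isSparse_scaledCoef hd.sparse).norm_sparseSum_sub_le fun n => ?_
    refine (abs_scaledCoef_sub_le hd hβ hβl hΛ h0 h2π 2 n hp hq).trans
      (mul_le_mul_of_nonneg_right ?_ (norm_nonneg _))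
    have hn := hd.lam_pos n
    rw [div_self (two_ne_zero' ℝ), Real.rpow_one]
    calc lam n * (β * |B n|) * (2 * L / lam n) * (C + 2 * Λ n)
        = β * (2 * L) * (|B n| * C + 2 * (|B n| * Λ n)) := by field_simp
      _ ≤ D := by
        rw [hD]
        refine mul_le_mul_of_nonneg_left ?_ (by positivity)
        have h3 := mul_le_mul_of_nonneg_right (hd.bound_B n) hC0
        linarith [hb' n]

lemma le_fractalDim_inSobolev (hd : IsSectorData lam B θ ψ M L C b) (hβ : 0 < β)
    (hβl : 4 * β ≤ lam 0) {φ : ℕ → ℝ} (hφ : ∀ n, φ n ∈ Ico 0 (2 * Real.pi))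
    (hψφ : ∀ n k, ψ n (φ k) = if n = k then 1 else 0) {s c κ : ℝ} (hc : 0 < c) (hκ : 0 < κ)
    (hB : ∀ᶠ n : ℕ in atTop, c * (n : ℝ) ^ (-κ) ≤ lam n ^ (s / 2 - 1) * B n) :
    ((1 + 1 / κ : ℝ) : EReal) ≤
      fractalDim (inSobolev e lam s (sectorAttractor e lam B θ ψ β)) := by
  have hL0 : 0 ≤ L := by simpa using (abs_nonneg _).trans (hd.lip 1 0)
  obtain ⟨N, hN⟩ := eventually_atTop.1 hB
  -- With `2Lδ ≤ 1/2` the profile keeps at least half of its value `1/λₙ` at `R = 1`; with `δ ≤ 1/2`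
  -- the segment avoids the origin.
  set δ := 1 / (4 * L + 2) with hδ
  have hδ0 : 0 < δ := by positivity
  have hδ1 : δ ≤ 1 / 2 := by
    rw [hδ, div_le_div_iff₀ (by positivity) two_pos]; linarith
  have hδL : 2 * L * δ ≤ 1 / 2 := by
    rw [hδ, mul_one_div, div_le_div_iff₀ (by positivity) two_pos]; linarith
  have hc2 : 0 < β * c / 2 := by positivity
  refine le_fractalDim_of_orthogonal_segments (e := e) (N₀ := N) (w := fun n => unitVec (φ n))
    (h := fun n R => lam n ^ (s / 2) * (β * B n) * profile β (lam n) θ R) hδ0 hc2 hκ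
    (fun n => norm_unitVec _) (fun n hn R hR => ?_) (fun n hn R hR => ?_)
  · have hR0 : 0 < R := by linarith [hR.1]
    have hnorm : ‖R • unitVec (φ n)‖ = R := by
      rw [norm_smul, norm_unitVec, mul_one, Real.norm_eq_abs, abs_of_pos hR0]
    have hang := polarAngle_smul_unitVec hR0 (hφ n)
    rw [inSobolev_sectorAttractor hd.sparse]
    refine ⟨R • unitVec (φ n), by simpa [hnorm] using hR.2, ?_⟩
    refine Prod.ext rfl ?_
    dsimp only
    rw [sparseSum_eq (n := n) fun m hm => by
      rw [scaledCoef_eq_bump, bump, hang, hψφ, if_neg hm, mul_zero], scaledCoef_eq_bump, bump,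
      hang, hψφ, if_pos rfl, mul_one, hnorm]
  · have hn0 := hd.lam_pos n
    have hR01 : R ∈ Icc (0 : ℝ) 1 := ⟨by linarith [hR.1], hR.2⟩
    have h1 := abs_profile_sub_le hβ (hβl.trans (hd.lam_mono (Nat.zero_le n))) hd.cont hd.bound
      hd.lip hR01 (right_mem_Icc.2 zero_le_one)
    rw [profile_one hn0 hd.one] at h1
    have h2 : |R - 1| ≤ δ := by rw [abs_le]; constructor <;> linarith [hR.1, hR.2]
    have h3 : 2 * L / lam n * |R - 1| ≤ 1 / 2 / lam n := by
      calc 2 * L / lam n * |R - 1| ≤ 2 * L / lam n * δ :=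
            mul_le_mul_of_nonneg_left h2 (by positivity)
        _ = 2 * L * δ / lam n := by ring
        _ ≤ _ := by gcongr
    have h4 : 1 / 2 / lam n ≤ profile β (lam n) θ R := by
      have h5 := (abs_le.1 (h1.trans h3)).1
      have h6 : 1 / lam n = 1 / 2 / lam n + 1 / 2 / lam n := by ring
      linarith
    have h7 := hN n hn
    have h8 : 0 ≤ lam n ^ (s / 2 - 1) * B n := le_trans (by positivity) h7
    have h9 : 0 ≤ lam n ^ (s / 2) * (β * B n) := by
      have h10 : lam n ^ (s / 2) * (β * B n) = β * lam n * (lam n ^ (s / 2 - 1) * B n) := by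
        rw [Real.rpow_sub_one hn0.ne']; field_simp
      rw [h10]; positivity
    calc β * c / 2 * (n : ℝ) ^ (-κ) = β / 2 * (c * (n : ℝ) ^ (-κ)) := by ring
      _ ≤ β / 2 * (lam n ^ (s / 2 - 1) * B n) := mul_le_mul_of_nonneg_left h7 (by positivity)
      _ = lam n ^ (s / 2) * (β * B n) * (1 / 2 / lam n) := by
          rw [Real.rpow_sub_one hn0.ne']; field_simp
      _ ≤ _ := mul_le_mul_of_nonneg_left h4 h9

end Dimension

/-! ### Asymptotics of eigenvalues and amplitudes. -/

section Asymptotic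

variable {lam a B : ℕ → ℝ}

lemma tendsto_lam_atTop (hlam : lam =Θ[atTop] fun n : ℕ => (n : ℝ) ^ 2)
    (hlam_pos : ∀ n, 0 < lam n) : Tendsto lam atTop atTop := by
  obtain ⟨c, hc, h⟩ := hlam.2.exists_pos
  have h1 : Tendsto (fun n : ℕ => c⁻¹ * (n : ℝ) ^ 2) atTop atTop :=
    Tendsto.const_mul_atTop (inv_pos.2 hc)
      ((tendsto_pow_atTop two_ne_zero).comp tendsto_natCast_atTop_atTop)
  refine tendsto_atTop_mono' _ ?_ h1
  filter_upwards [h.bound] with n hn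
  rw [Real.norm_of_nonneg (by positivity), Real.norm_of_nonneg (hlam_pos n).le] at hn
  rwa [inv_mul_le_iff₀ hc]

lemma tendsto_div_amplitude (hlam : Tendsto lam atTop atTop) (ha_pos : ∀ n, 0 < a n)
    (hB : ∀ n, 1 < lam n → B n = a n / Real.log (lam n)) :
    Tendsto (fun n => B n / a n) atTop (𝓝 0) := by
  refine (Real.tendsto_log_atTop.comp hlam).inv_tendsto_atTop.congr' ?_
  filter_upwards [hlam.eventually_gt_atTop 1] with n hn
  have := (ha_pos n).ne'
  rw [hB n hn]
  simp only [Pi.inv_apply, Function.comp]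
  field_simp

/-- The product is of order `(log λₙ)^(-3)`. It governs both the continuity of `F` into `H¹` and the
compactness at `s = 3`. -/
lemma tendsto_sqrt_mul_amplitude (hlam : Tendsto lam atTop atTop) (hlam_pos : ∀ n, 0 < lam n)
    (ha_pos : ∀ n, 0 < a n)
    (ha : a =Θ[atTop] fun n : ℕ => 1 / (lam n ^ (1 / 2 : ℝ) * Real.log (lam n) ^ 2))
    (hB : ∀ n, 1 < lam n → B n = a n / Real.log (lam n)) :
    Tendsto (fun n => lam n ^ (1 / 2 : ℝ) * B n) atTop (𝓝 0) := by
  obtain ⟨c, hc, h⟩ := ha.1.exists_pos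
  have h1 : Tendsto (fun n => c * (Real.log (lam n))⁻¹) atTop (𝓝 (c * 0)) :=
    (Real.tendsto_log_atTop.comp hlam).inv_tendsto_atTop.const_mul c
  rw [mul_zero] at h1
  refine squeeze_zero_norm' ?_ h1
  filter_upwards [h.bound, hlam.eventually_gt_atTop 1,
    (Real.tendsto_log_atTop.comp hlam).eventually_ge_atTop 1] with n hn hn1 hlog
  simp only [Function.comp] at hlog
  have hs : 0 < lam n ^ (1 / 2 : ℝ) := Real.rpow_pos_of_pos (hlam_pos n) _
  set l := Real.log (lam n) with hl
  have hl0 : 0 < l := by linarith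
  rw [Real.norm_of_nonneg (ha_pos n).le, Real.norm_of_nonneg (by positivity)] at hn
  rw [hB n hn1, Real.norm_of_nonneg (by have := ha_pos n; positivity), ← hl,
    div_eq_mul_inv (a n) l, ← mul_assoc]
  refine mul_le_mul_of_nonneg_right ?_ (by positivity)
  calc lam n ^ (1 / 2 : ℝ) * a n ≤
        lam n ^ (1 / 2 : ℝ) * (c * (1 / (lam n ^ (1 / 2 : ℝ) * l ^ 2))) :=
        mul_le_mul_of_nonneg_left hn hs.le
    _ = c / l ^ 2 := by field_simp
    _ ≤ c := div_le_self hc.le (one_le_pow₀ hlog)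

lemma exists_rpow_le_amplitude (hlam : Tendsto lam atTop atTop) (hlam_pos : ∀ n, 0 < lam n)
    (hlam2 : lam =Θ[atTop] fun n : ℕ => (n : ℝ) ^ 2) (ha_pos : ∀ n, 0 < a n)
    (ha : a =Θ[atTop] fun n : ℕ => 1 / (lam n ^ (1 / 2 : ℝ) * Real.log (lam n) ^ 2))
    (hB : ∀ n, 1 < lam n → B n = a n / Real.log (lam n)) {s κ : ℝ} (hκ : 0 < κ)
    (hsκ : 3 - s < κ) :
    ∃ c : ℝ, 0 < c ∧ ∀ᶠ n : ℕ in atTop, c * (n : ℝ) ^ (-κ) ≤ lam n ^ (s / 2 - 1) * B n := by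
  obtain ⟨c₁, hc₁, h₁⟩ := ha.2.exists_pos
  obtain ⟨c₂, hc₂, h₂⟩ := hlam2.1.exists_pos
  -- Three logarithms are absorbed into `λₙ^(3η)`, using up half of the gap; the total exponent of
  -- `λₙ` becomes exactly `-κ/2`.
  set η := (κ - (3 - s)) / 6 with hη
  have hη0 : 0 < η := by rw [hη]; linarith
  have hlog : ∀ᶠ n in atTop, Real.log (lam n) ≤ lam n ^ η := by
    have h := ((isLittleO_log_rpow_atTop hη0).bound one_pos)
    filter_upwards [hlam.eventually h, hlam.eventually_gt_atTop 1] with n hn hn1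
    rw [one_mul, Real.norm_of_nonneg (Real.log_nonneg hn1.le),
      Real.norm_of_nonneg (Real.rpow_nonneg (hlam_pos n).le _)] at hn
    exact hn
  refine ⟨c₁⁻¹ * c₂ ^ (-(κ / 2)), by positivity, ?_⟩
  filter_upwards [h₁.bound, h₂.bound, hlog, hlam.eventually_gt_atTop 1, eventually_gt_atTop 0]
    with n hn₁ hn₂ hlg hn1 hn0
  have hl := hlam_pos n
  have hlog0 : 0 < Real.log (lam n) := Real.log_pos hn1
  have hn0' : (0 : ℝ) < n := by exact_mod_cast hn0
  have hs : 0 < lam n ^ (1 / 2 : ℝ) := Real.rpow_pos_of_pos hl _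
  rw [Real.norm_of_nonneg (by positivity), Real.norm_of_nonneg (ha_pos n).le] at hn₁
  rw [Real.norm_of_nonneg hl.le, Real.norm_of_nonneg (by positivity)] at hn₂
  have h3 : lam n ^ (-(1 / 2) - 3 * η) ≤
      1 / (lam n ^ (1 / 2 : ℝ) * Real.log (lam n) ^ 2) / Real.log (lam n) := by
    rw [div_div, mul_assoc, ← pow_succ, ← Real.rpow_natCast,
      show -(1 / 2) - 3 * η = -(1 / 2 + η * 3) by ring, Real.rpow_neg hl.le,
      Real.rpow_add hl, Real.rpow_mul hl.le, ← one_div (lam n ^ (1 / 2 : ℝ) * _)]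
    have hlog3 : Real.log (lam n) ^ (((2 + 1 : ℕ)) : ℝ) ≤ (lam n ^ η) ^ (3 : ℝ) := by
      norm_num
      exact_mod_cast pow_le_pow_left₀ hlog0.le hlg 3
    gcongr
  have h4 : c₁⁻¹ * lam n ^ (-(1 / 2) - 3 * η) ≤ B n := by
    rw [hB n hn1]
    calc _ ≤ c₁⁻¹ * (1 / (lam n ^ (1 / 2 : ℝ) * Real.log (lam n) ^ 2) / Real.log (lam n)) :=
          mul_le_mul_of_nonneg_left h3 (by positivity)
      _ = (c₁⁻¹ * (1 / (lam n ^ (1 / 2 : ℝ) * Real.log (lam n) ^ 2))) / Real.log (lam n) := by ring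
      _ ≤ _ := by
        refine div_le_div_of_nonneg_right ?_ hlog0.le
        rwa [inv_mul_le_iff₀ hc₁]
  have h5 : c₂ ^ (-(κ / 2)) * (n : ℝ) ^ (-κ) ≤ lam n ^ (-(κ / 2)) := by
    have h6 : (n : ℝ) ^ (-κ) = ((n : ℝ) ^ 2) ^ (-(κ / 2)) := by
      rw [← Real.rpow_natCast, ← Real.rpow_mul hn0'.le]; congr 1; push_cast; ring
    rw [h6, ← Real.mul_rpow hc₂.le (by positivity)]
    exact Real.rpow_le_rpow_of_nonpos hl hn₂ (by linarith)
  calc c₁⁻¹ * c₂ ^ (-(κ / 2)) * (n : ℝ) ^ (-κ) = c₁⁻¹ * (c₂ ^ (-(κ / 2)) * (n : ℝ) ^ (-κ)) := by ring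
    _ ≤ c₁⁻¹ * lam n ^ (-(κ / 2)) := mul_le_mul_of_nonneg_left h5 (by positivity)
    _ = lam n ^ (s / 2 - 1) * (c₁⁻¹ * lam n ^ (-(1 / 2) - 3 * η)) := by
        rw [mul_left_comm, ← Real.rpow_add hl]
        congr 2
        rw [hη]; ring
    _ ≤ _ := mul_le_mul_of_nonneg_left h4 (Real.rpow_pos_of_pos hl _).le

end Asymptotic

/-! ### Disjointness of the angular cut-offs. -/

section AngularCutoffs

variable {a c : ℕ → ℝ} {ψ : ℕ → ℝ → ℝ}

/-- The set where a continuous function is non-zero is open. Adjacent intervals may share an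
endpoint, so this is what makes the family sparse. -/
lemma mem_Ioo_of_ne_zero (hψ : ∀ n, Continuous (ψ n))
    (hψ_supp : ∀ n, Function.support (ψ n) ⊆ Icc (c n) (c n + a n)) {n : ℕ} {x : ℝ}
    (h : ψ n x ≠ 0) : x ∈ Ioo (c n) (c n + a n) := by
  rw [← interior_Icc]
  exact interior_maximal (hψ_supp n) (hψ n).isOpen_support h

lemma isSparse_of_disjoint (hψ : ∀ n, Continuous (ψ n))
    (hψ_supp : ∀ n, Function.support (ψ n) ⊆ Icc (c n) (c n + a n))
    (hdisj : Pairwise fun m n => Disjoint (Ioo (c m) (c m + a m)) (Ioo (c n) (c n + a n))) :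
    IsSparse ψ := by
  intro x
  by_cases h : ∃ n, ψ n x ≠ 0
  · obtain ⟨n, hn⟩ := h
    refine ⟨n, fun m hm => ?_⟩
    by_contra hmx
    exact (Set.disjoint_left.1 (hdisj hm)) (mem_Ioo_of_ne_zero hψ hψ_supp hmx)
      (mem_Ioo_of_ne_zero hψ hψ_supp hn)
  · push Not at h
    exact ⟨0, fun m _ => h m⟩

end AngularCutoffs

end

/-! ### Assembly. -/

theorem theorem4p4
    {H : Type*} [NormedAddCommGroup H] [InnerProductSpace ℝ H] [CompleteSpace H]
    -- the operator, its eigenvalues and its orthonormal basis of eigenvectors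
    (A : H →ₗ.[ℝ] H) (hA : IsSelfAdjoint A)
    (e : HilbertBasis ℕ ℝ H) (lam : ℕ → ℝ)
    (hlam_pos : ∀ n, 0 < lam n) (hlam_mono : Monotone lam)
    (hAe : ∀ n, ∃ h : e n ∈ A.domain, A ⟨e n, h⟩ = lam n • e n)
    (hlam : lam =Θ[atTop] fun n : ℕ => (n : ℝ) ^ 2)
    -- the angular intervals `[c n, c n + a n]` of lengths `a n`
    (a c : ℕ → ℝ) (ha_pos : ∀ n, 0 < a n)
    (ha_summable : Summable a) (ha_sum : ∑' n, a n < 2 * Real.pi)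
    (hc : ∀ n, Icc (c n) (c n + a n) ⊆ Icc 0 (2 * Real.pi))
    (hc_disj : Pairwise fun m n => Disjoint (Ioo (c m) (c m + a m)) (Ioo (c n) (c n + a n)))
    (ha : a =Θ[atTop] fun n : ℕ => 1 / (lam n ^ (1 / 2 : ℝ) * Real.log (lam n) ^ 2))
    -- the amplitudes
    (B : ℕ → ℝ) (hB : ∀ n, 1 < lam n → B n = a n / Real.log (lam n))
    -- the angular cut-off functions
    (φ : ℕ → ℝ) (ψ : ℕ → ℝ → ℝ) (hφ : ∀ n, φ n ∈ Icc (c n) (c n + a n))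
    (hψ_smooth : ∀ n, ContDiff ℝ ∞ (ψ n))
    (hψ_supp : ∀ n, Function.support (ψ n) ⊆ Icc (c n) (c n + a n))
    (hψ_one : ∀ n k, ψ n (φ k) = if n = k then 1 else 0)
    (hψ_bound : ∀ k : ℕ, ∃ C : ℝ, ∀ n : ℕ, ∀ j ≤ k, ∀ x : ℝ,
      |iteratedDeriv j (ψ n) x| ≤ C * (a n ^ k)⁻¹)
    -- the radial cut-off function
    (θ : ℝ → ℝ) (hθ_smooth : ContDiff ℝ ∞ θ) (hθ_supp : HasCompactSupport θ)
    (hθ_zero : ∀ R ≤ 0, θ R = 0) (hθ_one : ∀ R ∈ Icc (1 / 2 : ℝ) 1, θ R = 1) :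
    -- `F ∈ C(ℝ², H¹)`
    ((∀ p, MemSobolev e lam 1 (sectorMap e B θ ψ p)) ∧
      Continuous fun p => sobolevPow e lam 1 (sectorMap e B θ ψ p)) ∧
    -- `F ∈ C¹(ℝ², H)`
    ContDiff ℝ 1 (sectorMap e B θ ψ) ∧
    -- the attractor for all small `β`
    ∃ β₀ : ℝ, 0 < β₀ ∧ ∀ β : ℝ, 0 < β → β < β₀ →
      ∃ (S : ℝ → Plane × H → Plane × H) (K : Set (Plane × H)),
        IsSolutionSemigroup A (sectorMap e B θ ψ) β S ∧
        IsGlobalAttractor S K ∧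
        -- `K ⊆ ℝ² × H^s`, and the dimension there as a function of `s`
        (∀ s : ℝ, ∀ u ∈ K, MemSobolev e lam s u.2) ∧
        (∀ s : ℝ, s ≤ 2 → fractalDim (inSobolev e lam s K) = 2) ∧
        (Monotone fun s : ℝ => fractalDim (inSobolev e lam s K)) ∧
        (∀ s : ℝ, 2 < s → 2 < fractalDim (inSobolev e lam s K)) ∧
        IsCompact (inSobolev e lam 3 K) ∧
        fractalDim (inSobolev e lam 3 K) = ⊤ := by
  -- asymptotics
  have hlamT := tendsto_lam_atTop hlam hlam_pos
  have hBa := tendsto_div_amplitude hlamT ha_pos hB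
  have hsB := tendsto_sqrt_mul_amplitude hlamT hlam_pos ha_pos ha hB
  have hB0 : Tendsto B atTop (𝓝 0) := by
    have h := hBa.mul ha_summable.tendsto_atTop_zero
    rw [mul_zero] at h
    exact h.congr fun n => div_mul_cancel₀ _ (ha_pos n).ne'
  obtain ⟨b, hb⟩ := (Metric.isBounded_range_of_tendsto B hB0).exists_norm_le
  -- angular cut-offs
  have hψ_cont : ∀ n, Continuous (ψ n) := fun n => (hψ_smooth n).continuous
  have hψ_sparse := isSparse_of_disjoint hψ_cont hψ_supp hc_disj
  have hψ_mem : ∀ n x, ψ n x ≠ 0 → x ∈ Ioo 0 (2 * Real.pi) := by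
    intro n x hx
    have h1 := mem_Ioo_of_ne_zero hψ_cont hψ_supp hx
    have h2 := hc n (left_mem_Icc.2 (by linarith [ha_pos n]))
    have h3 := hc n (right_mem_Icc.2 (by linarith [ha_pos n]))
    exact ⟨h2.1.trans_lt h1.1, h1.2.trans_le h3.2⟩
  have hψ_zero : ∀ n x, x ≤ 0 ∨ 2 * Real.pi ≤ x → ψ n x = 0 := by
    intro n x hx
    by_contra h
    have := hψ_mem n x h
    rcases hx with hx | hx
    · exact absurd this.1 (not_lt.2 hx)
    · exact absurd this.2 (not_lt.2 hx)
  have hφ_mem : ∀ n, φ n ∈ Ico 0 (2 * Real.pi) := fun n =>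
    Ioo_subset_Ico_self (hψ_mem n (φ n) (by rw [hψ_one, if_pos rfl]; exact one_ne_zero))
  obtain ⟨C, hC⟩ := hψ_bound 0
  have hCψ : ∀ n x, |ψ n x| ≤ C := fun n x => by simpa using hC n 0 le_rfl x
  obtain ⟨C₁, hC₁⟩ := hψ_bound 1
  set Λ : ℕ → ℝ := fun n => C₁ * (a n)⁻¹ with hΛdef
  have hΛ : ∀ n x y, |ψ n x - ψ n y| ≤ Λ n * |x - y| := by
    intro n x y
    refine Convex.norm_image_sub_le_of_norm_deriv_le (s := univ)
      (fun z _ => ((hψ_smooth n).differentiable (by simp)) z) (fun z _ => ?_) convex_univ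
      (mem_univ y) (mem_univ x)
    simpa using hC₁ n 1 le_rfl z
  have hBΛ0 : Tendsto (fun n => |B n| * Λ n) atTop (𝓝 0) := by
    have h := hBa.abs.const_mul C₁
    rw [abs_zero, mul_zero] at h
    refine h.congr fun n => ?_
    rw [abs_div, abs_of_pos (ha_pos n)]
    simp only [hΛdef]; ring
  obtain ⟨b', hb'⟩ := (Metric.isBounded_range_of_tendsto _ hBΛ0).exists_norm_le
  -- the radial cut-off
  have hθ1 : ContDiff ℝ 1 θ := hθ_smooth.of_le (by exact_mod_cast le_top)
  obtain ⟨M, hM⟩ := hθ_supp.exists_bound_of_continuous hθ_smooth.continuous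
  obtain ⟨L, hL⟩ := hθ1.lipschitzWith_of_hasCompactSupport hθ_supp one_ne_zero
  have hLθ : ∀ x y, |θ x - θ y| ≤ (L : ℝ) * |x - y| := fun x y => hL.dist_le_mul x y
  have hθ0 : θ 0 = 0 := hθ_zero 0 le_rfl
  have hd : IsSectorData lam B θ ψ M L C b :=
    { lam_pos := hlam_pos
      lam_mono := hlam_mono
      sparse := hψ_sparse
      cont := hθ_smooth.continuous
      bound := hM
      lip := hLθ
      zero := hθ0
      one := hθ_one 1 ⟨by norm_num, le_rfl⟩
      bound_ψ := hCψ
      bound_B := fun n => hb _ (mem_range_self n) }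
  -- the map `F`
  set T : ℕ → Plane → ℝ := fun n => bump (fun R => B n * θ R) (ψ n) with hT
  have hFT : sectorMap e B θ ψ = sparseSum e T := rfl
  have hTs : IsSparse T := fun p => (hψ_sparse (polarAngle p)).imp fun n hn m hm => by
    simp only [hT, bump, hn m hm, mul_zero]
  have hTc : ∀ n, ContDiff ℝ 1 (T n) := fun n =>
    contDiff_bump (contDiff_const.mul hθ1) (fun R hR => by rw [hθ_zero R hR, mul_zero])
      ((hψ_smooth n).of_le (by exact_mod_cast le_top)) (hψ_zero n) (hCψ n) (hΛ n)
  have hTb : ∀ n p, |T n p| ≤ |B n| * M * C := by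
    intro n p
    simp only [hT, bump, abs_mul]
    exact mul_le_mul (mul_le_mul_of_nonneg_left (hM _) (abs_nonneg _)) (hCψ n _) (abs_nonneg _)
      (mul_nonneg (abs_nonneg _) ((norm_nonneg _).trans (hM 0)))
  have hTL : ∀ n p q, |T n p - T n q| ≤ |B n| * L * (C + 2 * Λ n) * ‖p - q‖ := by
    intro n p q
    refine bump_lipschitz (r := max ‖p‖ ‖q‖) (fun R hR => ?_) (fun R _ R' _ => ?_) (hCψ n) (hΛ n)
      (hψ_zero n 0 (Or.inl le_rfl)) (hψ_zero n _ (Or.inr le_rfl)) (le_max_left _ _)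
      (le_max_right _ _)
    · have := hLθ R 0
      rw [hθ0, sub_zero, sub_zero, abs_of_nonneg hR.1] at this
      rw [abs_mul, mul_assoc]
      exact mul_le_mul_of_nonneg_left this (abs_nonneg _)
    · rw [← mul_sub, abs_mul, mul_assoc]
      exact mul_le_mul_of_nonneg_left (hLθ R R') (abs_nonneg _)
  refine ⟨⟨fun p => hFT ▸ hTs.memSobolev lam 1 p, ?_⟩, ?_, ?_⟩
  · simp only [hFT, hTs.sobolevPow_sparseSum]
    rw [← continuousOn_univ]
    refine (hTs.const_mul fun n => lam n ^ (1 / 2 : ℝ)).continuousOn_sparseSum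
      (b := fun n => |lam n ^ (1 / 2 : ℝ) * B n| * (M * C))
      (fun n => (continuous_const.mul (hTc n).continuous).continuousOn) (fun n p _ => ?_) ?_
    · rw [abs_mul, abs_mul, mul_assoc]
      exact mul_le_mul_of_nonneg_left ((hTb n p).trans (le_of_eq (mul_assoc _ _ _))) (abs_nonneg _)
    · have := hsB.abs.mul_const (M * C)
      simpa using this
  · rw [hFT]
    refine hTs.contDiff_sparseSum hTc hTL ?_
    have h := ((hB0.abs.mul_const C).add (hBΛ0.const_mul 2)).const_mul (L : ℝ)
    simp only [abs_zero, zero_mul, mul_zero, add_zero] at h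
    exact h.congr fun n => by ring
  -- The threshold is the condition `4β ≤ λ₀` of the profile estimates.
  · refine ⟨lam 0 / 4, by have := hlam_pos 0; positivity, fun β hβ hβ0 => ?_⟩
    have hβl : 4 * β ≤ lam 0 := by linarith
    have hψ0 : ∀ n, ψ n 0 = 0 := fun n => hψ_zero n 0 (Or.inl le_rfl)
    have hψ2π : ∀ n, ψ n (2 * Real.pi) = 0 := fun n => hψ_zero n _ (Or.inr le_rfl)
    have hKs : ∀ s : ℝ, ∀ u ∈ sectorAttractor e lam B θ ψ β, MemSobolev e lam s u.2 := by
      rintro s _ ⟨p, -, rfl⟩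
      exact (isSparse_trajCoef hψ_sparse).memSobolev lam s p
    have hmono := fractalDim_inSobolev_mono hlam_pos hlam_mono hKs
    have hlow : ∀ s κ : ℝ, 0 < κ → 3 - s < κ → ((1 + 1 / κ : ℝ) : EReal) ≤
        fractalDim (inSobolev e lam s (sectorAttractor e lam B θ ψ β)) := by
      intro s κ hκ hsκ
      obtain ⟨c', hc', h⟩ := exists_rpow_le_amplitude hlamT hlam_pos hlam ha_pos ha hB hκ hsκ
      exact le_fractalDim_inSobolev hd hβ hβl hφ_mem hψ_one hc' hκ h
    have hK : IsCompact (sectorAttractor e lam B θ ψ β) := by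
      have h0 : inSobolev e lam 0 (sectorAttractor e lam B θ ψ β) =
          sectorAttractor e lam B θ ψ β := by
        simp only [inSobolev, sobolevPow_zero, Prod.mk.eta, image_id']
      rw [← h0]
      refine isCompact_inSobolev_sectorAttractor hd hβ hβl hΛ hψ0 hψ2π ?_
      have h1 := hlamT.inv_tendsto_atTop.mul hB0
      rw [mul_zero] at h1
      refine h1.congr fun n => ?_
      rw [zero_div, zero_sub, Real.rpow_neg_one]
      rfl
    refine ⟨sectorFlow e lam B θ ψ β, sectorAttractor e lam B θ ψ β,
      isSolutionSemigroup_sectorFlow hA hAe hd hβ,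
      isGlobalAttractor_sectorAttractor hd hβ hβl hK, hKs, fun s hs => ?_, hmono, fun s hs => ?_,
      ?_, ?_⟩
    · exact le_antisymm ((hmono hs).trans (fractalDim_inSobolev_two_le hd hβ hβl hΛ hψ0 hψ2π
        fun n => (le_abs_self _).trans (hb' _ (mem_range_self n))))
        (two_le_fractalDim_inSobolev hψ_sparse s)
    -- For `2 < r ≤ 5/2` the exponent `κ = (4 - r) / 2` lies strictly between `3 - r` and `1`;
    -- capping `s` keeps it positive.
    · set r := min s (5 / 2) with hr
      have hr2 : 2 < r := lt_min hs (by norm_num)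
      have hr3 : r ≤ 5 / 2 := min_le_right _ _
      refine lt_of_lt_of_le ?_ ((hlow r ((4 - r) / 2) (by linarith) (by linarith)).trans
        (hmono (min_le_left _ _)))
      have h1 : (2 : ℝ) < 1 + 1 / ((4 - r) / 2) := by
        have : 1 < 1 / ((4 - r) / 2) := by
          rw [lt_div_iff₀ (by linarith)]; linarith
        linarith
      exact (EReal.coe_lt_coe_iff (x := 2)).2 h1
    · refine isCompact_inSobolev_sectorAttractor hd hβ hβl hΛ hψ0 hψ2π (hsB.congr fun n => ?_)
      norm_num
    · rw [EReal.eq_top_iff_forall_lt]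
      intro y
      -- At `s = 3` any `κ > 0` is allowed; this one pushes `1 + 1/κ` above `y`.
      have h1 := hlow 3 (1 / (|y| + 1)) (by positivity) (by rw [sub_self]; positivity)
      refine lt_of_lt_of_le ?_ h1
      rw [one_div_one_div]
      have : y < 1 + (|y| + 1) := by linarith [le_abs_self y]
      exact_mod_cast this
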